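/- For a positive integer $n$, let $K_n^*$ denote the complete graph $K_n$ if $n$ is odd, and $K_n$ with the edges of a $1$-factor removed if $n$ is even. For integers $v > m \ge 3$, a $\mathrm{UMSF}(v,m,k)$ (uniform minisymposium factorization) is a factorization of a $K_v^*$ into $2$-factors $$F_i \ \Bigl(1\le i\le \bigl\lfloor\tfrac{v-1}{2}\bigr\rfloor-\bigl\lfloor\tfrac{m-1}{2}\bigr\rfloor\Bigr),\qquad T_j\cup U_j\ \Bigl(1\le j\le \bigl\lfloor\tfrac{m-1}{2}\bigr\rfloor\Bigr),$$ for which there is a set $M$ of $m$ vertices such that each $T_j$ is a $2$-regular graph with vertex set $M$, each $U_j$ is a $2$-regular graph whose vertex set is the complement of $M$, the $T_j$ factorize a subgraph of the $K_v^*$ with vertex set $M$ that is isomorphic to $K_m^*$ (where, if $v$ and $m$ are both even, the $1$-factor of the complete graph on $M$ that is missing from this $K_m^*$ is contained in the $1$-factor missing from the $K_v^*$), and every cycle in every $F_i$, $T_j$ and $U_j$ has length $k$. Let $k>3$ with $k\equiv 2 \pmod 4$, and let $v>m$ be positive integers with $v\equiv m\equiv k \pmod{2k}$. Then a $\mathrm{UMSF}(v,m,k)$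 exists if and only if $v\ge 2m$. -/

import Mathlib

/-- A graph `H` on the vertex set `V` that is 2-regular, i.e. a 2-factor on the vertices `V`. -/
def IsTwoRegular {V : Type*} (H : SimpleGraph V) : Prop :=
  ∀ x, (H.neighborSet x).ncard = 2

/-- `I` is (the edge set of) a 1-factor on the vertices `V`. -/
def IsOneFactor {V : Type*} (I : SimpleGraph V) : Prop :=
  ∀ x, ∃! y, I.Adj x y

/-- `G` is a copy of `K_n^*` on the vertex set `V`, where `n` is the number of vertices:
the complete graph if `n` is odd, the complete graph minus a 1-factor if `n` is even. -/
def IsKStar {V : Type*} (G : SimpleGraph V) : Prop :=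
  (Odd (Nat.card V) → G = ⊤) ∧
    (Even (Nat.card V) → ∃ I : SimpleGraph V, IsOneFactor I ∧ G = ⊤ \ I)

/-- The spanning subgraphs `H i` factorize `G`: each edge of `G` lies in exactly one of them. -/
def IsFactorization {V ι : Type*} (G : SimpleGraph V) (H : ι → SimpleGraph V) : Prop :=
  (∀ i, H i ≤ G) ∧ ∀ x y, G.Adj x y → ∃! i, (H i).Adj x y

/-- The disjoint union of a graph on `M` and a graph on the complement of `M`,
as a graph on the whole vertex set. -/
def glue {V : Type*} {M : Set V} (T : SimpleGraph M) (U : SimpleGraph (Mᶜ : Set V)) :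
    SimpleGraph V :=
  T.map (Function.Embedding.subtype (· ∈ M)) ⊔ U.map (Function.Embedding.subtype (· ∈ Mᶜ))

/-- A minisymposium factorization on `v` vertices with a subsystem on `m` vertices. -/
structure MinisymposiumFactorization (v m : ℕ) where
  /-- the copy of `K_v^*` that is factorized -/
  K : SimpleGraph (Fin v)
  isKStar_K : IsKStar K
  /-- the vertices of the subsystem -/
  M : Set (Fin v)
  card_M : Nat.card M = m
  /-- the copy of `K_m^*` on the vertices of the subsystem, a subgraph of `K` -/
  L : SimpleGraph M
  isKStar_L : IsKStar L
  L_le : L ≤ K.induce M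
  /-- If `v` and `m` are both even, then the 1-factor missing from `K_m^*` is contained in
  the 1-factor missing from `K_v^*`. -/
  le_L : Even v → Even m → K.induce M ≤ L
  F : Fin ((v - 1) / 2 - (m - 1) / 2) → SimpleGraph (Fin v)
  T : Fin ((m - 1) / 2) → SimpleGraph M
  U : Fin ((m - 1) / 2) → SimpleGraph (Mᶜ : Set (Fin v))
  isTwoRegular_F : ∀ i, IsTwoRegular (F i)
  isTwoRegular_T : ∀ i, IsTwoRegular (T i)
  isTwoRegular_U : ∀ i, IsTwoRegular (U i)
  isFactorization_T : IsFactorization L T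
  isFactorization : IsFactorization K (Sum.elim F fun i => glue (T i) (U i))

/-- Every connected component of `H` is a cycle of length `k` (for `3 ≤ k`). -/
def IsUniformCycles {V : Type*} (k : ℕ) (H : SimpleGraph V) : Prop :=
  ∀ c : H.ConnectedComponent, Nonempty (c.toSimpleGraph ≃g SimpleGraph.cycleGraph k)

/-- A `UMSF(v, m, k)`: all the 2-factors consist of cycles of length `k`. -/
structure UMSF (v m k : ℕ) extends MinisymposiumFactorization v m where
  uniform_F : ∀ i, IsUniformCycles k (F i)
  uniform_T : ∀ i, IsUniformCycles k (T i)
  uniform_U : ∀ i, IsUniformCycles k (U i)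

/-! Necessity is a degree count. A vertex outside `M` is joined in `K` to all `m` vertices of `M`,
these edges can only lie in the `F i`, and there are `(v - m) / 2` of those, with two edges each at
the vertex.

For sufficiency write `k = 2 * h` with `h` odd, `m = 2 * n`, `v = 2 * n + 4 * g`, where `h` divides
the odd number `n` and also `g`. Vertices are taken as pairs `(x, s)` with `s : Bool` and `x` in a
base set of `n + 2 * g` points, and the missing 1-factor consists of the pairs over one point.

Doubling (`HasLevel.exists_double`): a 2-factor of the base whose cycle lengths are multiples of `h`
lifts to two 2-factors with all cycles of length `2 * h`, which share the four lifts of each of its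
edges. So the cycles in the base may be long, and Hamilton cycles are allowed.

Base problem (`hasBaseCover`): the base is `Fin n` together with two copies of `ZMod g`. The pairs
not inside `Fin n` are covered by `g` Hamilton cycles on everything and `(n - 1) / 2` 2-factors on
the two copies. The Hamilton cycles are translates under `ZMod g` of one or two explicit cycles, and
the leftover differences are handled by 2-factors built from Walecki zigzags or from pairs of mixed
differences. The pairs inside `Fin n` are covered by Walecki's Hamilton cycles.

Only covering is ever proved. The number of 2-factors is exactly what the degrees allow, so no edge
is covered twice (`joins_unique_of_cover`). -/

open Equiv Function

/-! ### Uniform 2-factors as permutations with constant cycle length -/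

/-- The permutation `σ` maps one of `x` and `y` to the other. -/
def Joins {V : Type*} (σ : Perm V) (x y : V) : Prop := σ x = y ∨ σ y = x

theorem Joins.symm {V : Type*} {σ : Perm V} {x y : V} (h : Joins σ x y) : Joins σ y x := Or.symm h

theorem joins_permCongr {V W : Type*} (e : V ≃ W) (σ : Perm V) (x y : V) :
    Joins (e.permCongr σ) (e x) (e y) ↔ Joins σ x y := by
  simp [Joins, Equiv.permCongr_apply]

theorem minimalPeriod_permCongr {V W : Type*} (e : V ≃ W) (σ : Perm V) (x : V) :
    minimalPeriod (e.permCongr σ) (e x) = minimalPeriod σ x := by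
  apply minimalPeriod_eq_minimalPeriod_iff.2
  intro n
  have h : Semiconj e σ (e.permCongr σ) := fun x => by simp [Equiv.permCongr_apply]
  have := (h.iterate_right n) x
  simp only [IsPeriodicPt, IsFixedPt, ← this, e.apply_eq_iff_eq]

/-- The graph whose edges join each vertex to its image under a permutation. -/
def permGraph {V : Type*} (σ : Perm V) : SimpleGraph V where
  Adj x y := x ≠ y ∧ Joins σ x y
  symm := ⟨fun _ _ h => ⟨h.1.symm, h.2.symm⟩⟩
  loopless := ⟨fun _ h => h.1 rfl⟩

section
variable {V : Type*} {σ : Perm V} {k : ℕ}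

theorem apply_ne_of_minimalPeriod (hk : 3 ≤ k) (hσ : ∀ x, minimalPeriod σ x = k) (x : V) :
    σ x ≠ x := by
  intro h
  have : IsPeriodicPt σ 1 x := h
  have := this.minimalPeriod_dvd
  rw [hσ] at this
  have := Nat.le_of_dvd one_pos this
  omega

theorem apply_ne_symm_of_minimalPeriod (hk : 3 ≤ k) (hσ : ∀ x, minimalPeriod σ x = k) (x : V) :
    σ x ≠ σ.symm x := by
  intro h
  have : IsPeriodicPt σ 2 x := by
    change σ (σ x) = x
    rw [h]; simp
  have := this.minimalPeriod_dvd
  rw [hσ] at this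
  have := Nat.le_of_dvd two_pos this
  omega

theorem permGraph_adj (hk : 3 ≤ k) (hσ : ∀ x, minimalPeriod σ x = k) {x y : V} :
    (permGraph σ).Adj x y ↔ Joins σ x y := by
  refine ⟨fun h => h.2, fun h => ⟨?_, h⟩⟩
  rintro rfl
  rcases h with h | h <;> exact apply_ne_of_minimalPeriod hk hσ x h

theorem isTwoRegular_permGraph (hk : 3 ≤ k) (hσ : ∀ x, minimalPeriod σ x = k) :
    IsTwoRegular (permGraph σ) := by
  intro x
  have : (permGraph σ).neighborSet x = {σ x, σ.symm x} := by
    ext y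
    rw [SimpleGraph.mem_neighborSet, permGraph_adj hk hσ]
    simp only [Joins, Set.mem_insert_iff, Set.mem_singleton_iff, Equiv.eq_symm_apply]
    tauto
  rw [this, Set.ncard_pair (apply_ne_symm_of_minimalPeriod hk hσ x)]

theorem iterate_eq_iterate_iff_modEq (hk : 0 < k) (hσ : ∀ x, minimalPeriod σ x = k) (x : V)
    (i j : ℕ) : σ^[i] x = σ^[j] x ↔ i ≡ j [MOD k] := by
  rw [← iterate_mod_minimalPeriod_eq (f := σ) (n := i),
    ← iterate_mod_minimalPeriod_eq (f := σ) (n := j), hσ,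
    iterate_eq_iterate_iff_of_lt_minimalPeriod (by rw [hσ]; exact Nat.mod_lt _ hk)
    (by rw [hσ]; exact Nat.mod_lt _ hk)]
  rfl

/-- A backward step equals `k - 1` forward ones, so a component is a forward orbit, and the exponent
modulo `k` identifies it with the cycle. -/
theorem isUniformCycles_permGraph (hk : 3 ≤ k) (hσ : ∀ x, minimalPeriod σ x = k) :
    IsUniformCycles k (permGraph σ) := by
  intro c
  obtain ⟨x, rfl⟩ := c.exists_rep
  have hk0 : NeZero k := ⟨by omega⟩
  have hsurj : ∀ y z, (permGraph σ).Reachable y z → ∃ i : ℕ, σ^[i] y = z := by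
    rintro y z ⟨w⟩
    induction w with
    | nil => exact ⟨0, rfl⟩
    | @cons u v w huv _ ih =>
      obtain ⟨i, hi⟩ := ih
      rw [permGraph_adj hk hσ] at huv
      rcases huv with h | h
      · exact ⟨i + 1, by rw [iterate_succ_apply, h, hi]⟩
      · refine ⟨i + (k - 1), ?_⟩
        rw [← h, ← iterate_succ_apply, ← hi,
          iterate_eq_iterate_iff_modEq (by lia) hσ]
        rw [show (i + (k - 1)).succ = i + k by omega]
        simp
  have hreach : ∀ i : ℕ, (permGraph σ).Reachable (σ^[i] x) x := by
    intro i
    induction i with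
    | zero => exact SimpleGraph.Reachable.refl _
    | succ i ih =>
      refine SimpleGraph.Reachable.trans (SimpleGraph.Adj.reachable ?_) ih
      rw [permGraph_adj hk hσ, iterate_succ_apply']
      exact Or.inr rfl
  let f : Fin k → ((permGraph σ).connectedComponentMk x) :=
    fun i => ⟨σ^[(i : ℕ)] x, (SimpleGraph.ConnectedComponent.sound (hreach i) :)⟩
  have hf : Bijective f := by
    constructor
    · intro i j hij
      have := congrArg Subtype.val hij
      rw [iterate_eq_iterate_iff_modEq (by lia) hσ] at this
      exact Fin.ext (Nat.ModEq.eq_of_lt_of_lt this i.2 j.2)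
    · rintro ⟨y, hy⟩
      have hy' : (permGraph σ).Reachable y x := SimpleGraph.ConnectedComponent.exact hy
      obtain ⟨i, hi⟩ := hsurj x y hy'.symm
      refine ⟨⟨i % k, Nat.mod_lt _ (by omega)⟩, Subtype.ext ?_⟩
      change σ^[i % k] x = y
      rw [← hi, iterate_eq_iterate_iff_modEq (by lia) hσ]
      exact Nat.mod_modEq _ _
  refine ⟨SimpleGraph.Iso.symm ⟨Equiv.ofBijective f hf, ?_⟩⟩
  intro i j
  change (permGraph σ).Adj (σ^[(i : ℕ)] x) (σ^[(j : ℕ)] x) ↔ _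
  rw [permGraph_adj hk hσ, Joins, ← iterate_succ_apply' (⇑σ) (i : ℕ), ← iterate_succ_apply' (⇑σ) (j : ℕ),
    iterate_eq_iterate_iff_modEq (by lia) hσ, iterate_eq_iterate_iff_modEq (by lia) hσ, SimpleGraph.cycleGraph_adj', or_comm]
  have key : ∀ i j : Fin k, ((j : ℕ).succ ≡ i [MOD k]) ↔ (i - j).val = 1 := by
    intro i j
    have hi := i.2
    have hj := j.2
    rw [Fin.val_sub, Nat.ModEq, Nat.mod_eq_of_lt hi]
    rcases lt_or_ge (j : ℕ) i with h | h
    · rw [show k - (j : ℕ) + i = (i - j) + k by omega, Nat.add_mod_right,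
        Nat.mod_eq_of_lt (by omega), Nat.mod_eq_of_lt (by omega)]
      omega
    · rcases eq_or_lt_of_le h with h | h
      · rw [show k - (j : ℕ) + i = k by omega, Nat.mod_self, h]
        rcases eq_or_lt_of_le (Nat.succ_le_of_lt hj) with h' | h'
        · rw [h', Nat.mod_self]; omega
        · rw [Nat.mod_eq_of_lt h']; omega
      · rw [Nat.mod_eq_of_lt (a := k - (j : ℕ) + i) (by omega)]
        rcases eq_or_lt_of_le (Nat.succ_le_of_lt hj) with h' | h'
        · rw [h', Nat.mod_self]; omega
        · rw [Nat.mod_eq_of_lt h']; omega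
  rw [key, key]

end

/-! ### From covers by permutations to factorizations -/

theorem injective_and_mem_of_card_le {α β : Type*} [Fintype α] [DecidableEq β] (f : α → β)
    (S : Finset β) (hS : ∀ b ∈ S, ∃ a, f a = b) (hc : Fintype.card α ≤ S.card) :
    Injective f ∧ ∀ a, f a ∈ S := by
  have hsub : S ⊆ Finset.univ.image f := fun b hb => by simpa using hS b hb
  have h1 : (Finset.univ.image f).card ≤ Fintype.card α := Finset.card_image_le
  have heq : S = Finset.univ.image f := Finset.eq_of_subset_of_card_le hsub (h1.trans hc)
  refine ⟨?_, fun a => heq ▸ Finset.mem_image_of_mem f (Finset.mem_univ a)⟩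
  have : (Finset.univ.image f).card = (Finset.univ : Finset α).card :=
    le_antisymm h1 (by rw [← heq]; exact hc)
  exact fun a b hab => Finset.card_image_iff.1 this (by simp) (by simp) hab

/-- Permutations that cover all edges off a 1-factor, and are few enough, cover no edge twice. -/
theorem joins_unique_of_cover {V ι : Type*} [Fintype V] [DecidableEq V] [Fintype ι]
    (σ : ι → Perm V) (J : V → V) (hJ : ∀ x, J x ≠ x)
    (hcard : 2 * Fintype.card ι + 2 = Fintype.card V)
    (hcov : ∀ x y, x ≠ y → y ≠ J x → ∃ i, Joins (σ i) x y) :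
    (∀ i x y, Joins (σ i) x y → x ≠ y ∧ y ≠ J x) ∧
      ∀ x y i j, Joins (σ i) x y → Joins (σ j) x y → i = j := by
  -- At `x` there are `2 * card ι` pairs (index, direction), as many as vertices other than `x` and
  -- `J x`. All of these vertices are hit, so each is hit once and nothing else is.
  have key : ∀ x, Injective (fun p : ι × Bool => cond p.2 (σ p.1 x) ((σ p.1).symm x)) ∧
      ∀ p : ι × Bool, cond p.2 (σ p.1 x) ((σ p.1).symm x) ∈
        (Finset.univ \ {x, J x} : Finset V) := by
    intro x
    apply injective_and_mem_of_card_le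
    · intro y hy
      simp only [Finset.mem_sdiff, Finset.mem_univ, true_and, Finset.mem_insert,
        Finset.mem_singleton, not_or] at hy
      obtain ⟨i, hi | hi⟩ := hcov x y (Ne.symm hy.1) hy.2
      · exact ⟨(i, true), hi⟩
      · exact ⟨(i, false), by simp [← hi]⟩
    · rw [Finset.card_sdiff_of_subset (Finset.subset_univ _), Finset.card_pair (hJ x).symm]
      simp only [Fintype.card_prod, Fintype.card_bool, Finset.card_univ]
      omega
  have hp : ∀ i x y, Joins (σ i) x y → ∃ b : Bool, cond b (σ i x) ((σ i).symm x) = y := by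
    rintro i x y (h | h)
    · exact ⟨true, h⟩
    · exact ⟨false, by simp [← h]⟩
  refine ⟨fun i x y h => ?_, fun x y i j hi hj => ?_⟩
  · obtain ⟨b, hb⟩ := hp i x y h
    have := (key x).2 (i, b)
    simp only [hb, Finset.mem_sdiff, Finset.mem_univ, true_and, Finset.mem_insert,
      Finset.mem_singleton, not_or] at this
    exact ⟨Ne.symm this.1, this.2⟩
  · obtain ⟨b, hb⟩ := hp i x y hi
    obtain ⟨c, hc⟩ := hp j x y hj
    have := @(key x).1 (i, b) (j, c) (hb.trans hc.symm)
    exact congrArg Prod.fst this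

/-- The permutation that acts by `σ` on `A × Bool` and by `τ` on `B × Bool`. -/
def gluePerm {A B : Type*} (σ : Perm (A × Bool)) (τ : Perm (B × Bool)) :
    Perm ((A ⊕ B) × Bool) :=
  (Equiv.sumProdDistrib A B Bool).symm.permCongr (Equiv.sumCongr σ τ)

section
variable {A B : Type*} (σ : Perm (A × Bool)) (τ : Perm (B × Bool))

theorem gluePerm_inl (a : A) (s : Bool) :
    gluePerm σ τ (Sum.inl a, s) = (Sum.inl (σ (a, s)).1, (σ (a, s)).2) := by
  simp [gluePerm, Equiv.permCongr_apply]

theorem gluePerm_inr (b : B) (s : Bool) :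
    gluePerm σ τ (Sum.inr b, s) = (Sum.inr (τ (b, s)).1, (τ (b, s)).2) := by
  simp [gluePerm, Equiv.permCongr_apply]

theorem joins_gluePerm_inl (a a' : A) (s t : Bool) :
    Joins (gluePerm σ τ) (Sum.inl a, s) (Sum.inl a', t) ↔ Joins σ (a, s) (a', t) := by
  simp [Joins, gluePerm_inl, Prod.ext_iff]

theorem joins_gluePerm_inr (b b' : B) (s t : Bool) :
    Joins (gluePerm σ τ) (Sum.inr b, s) (Sum.inr b', t) ↔ Joins τ (b, s) (b', t) := by
  simp [Joins, gluePerm_inr, Prod.ext_iff]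

theorem not_joins_gluePerm_inl_inr (a : A) (b : B) (s t : Bool) :
    ¬ Joins (gluePerm σ τ) (Sum.inl a, s) (Sum.inr b, t) := by
  simp [Joins, gluePerm_inl, gluePerm_inr]

end

-- Coverage is enough because the numbers of permutations meet the degree count with equality. In
-- particular the count, not a hypothesis, keeps the `F i` away from edges inside `A × Bool`.
set_option maxHeartbeats 1000000 in
theorem nonempty_UMSF_of_perms {A B : Type*} [Fintype A] [Fintype B]
    [DecidableEq A] [DecidableEq B] {v m k : ℕ} (hk : 3 ≤ k) (hA : 0 < Fintype.card A)
    (hv : v = 2 * (Fintype.card A + Fintype.card B)) (hm : m = 2 * Fintype.card A)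
    (F : Fin ((v - 1) / 2 - (m - 1) / 2) → Perm ((A ⊕ B) × Bool))
    (T : Fin ((m - 1) / 2) → Perm (A × Bool)) (U : Fin ((m - 1) / 2) → Perm (B × Bool))
    (hF : ∀ i x, minimalPeriod (F i) x = k) (hT : ∀ i x, minimalPeriod (T i) x = k)
    (hU : ∀ i x, minimalPeriod (U i) x = k)
    (hAA : ∀ a a' s t, a ≠ a' → ∃ j, Joins (T j) (a, s) (a', t))
    (hAB : ∀ a b s t, ∃ i, Joins (F i) (Sum.inl a, s) (Sum.inr b, t))
    (hBB : ∀ b b' s t, b ≠ b' → (∃ i, Joins (F i) (Sum.inr b, s) (Sum.inr b', t)) ∨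
      ∃ j, Joins (U j) (b, s) (b', t)) : Nonempty (UMSF v m k) := by
  classical
  have hcardV : Fintype.card ((A ⊕ B) × Bool) = v := by
    simp [hv, mul_comm]
  obtain ⟨e⟩ : Nonempty ((A ⊕ B) × Bool ≃ Fin v) := ⟨Fintype.equivFinOfCardEq hcardV⟩
  let M : Set (Fin v) := {x | (e.symm x).1.isLeft}
  have hMl : ∀ a s, e (Sum.inl a, s) ∈ M := fun a s => by simp [M]
  have hMr : ∀ b s, e (Sum.inr b, s) ∈ Mᶜ := fun b s => by simp [M]
  let eA : A × Bool ≃ M := Equiv.ofBijective (fun p => ⟨e (Sum.inl p.1, p.2), hMl _ _⟩) (by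
    constructor
    · rintro ⟨a, s⟩ ⟨b, t⟩ h
      simpa using h
    · rintro ⟨x, hx⟩
      obtain ⟨⟨a | b, s⟩, rfl⟩ := e.surjective x
      · exact ⟨(a, s), rfl⟩
      · exact absurd hx (hMr b s))
  let eB : B × Bool ≃ (Mᶜ : Set (Fin v)) :=
    Equiv.ofBijective (fun p => ⟨e (Sum.inr p.1, p.2), hMr _ _⟩) (by
    constructor
    · rintro ⟨a, s⟩ ⟨b, t⟩ h
      simpa using h
    · rintro ⟨x, hx⟩
      obtain ⟨⟨a | b, s⟩, rfl⟩ := e.surjective x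
      · exact absurd (hMl a s) hx
      · exact ⟨(b, s), rfl⟩)
  have heA : ∀ a s, (eA (a, s) : Fin v) = e (Sum.inl a, s) := fun _ _ => rfl
  have heB : ∀ b s, (eB (b, s) : Fin v) = e (Sum.inr b, s) := fun _ _ => rfl
  let σ : Fin ((v - 1) / 2 - (m - 1) / 2) ⊕ Fin ((m - 1) / 2) → Perm ((A ⊕ B) × Bool) :=
    Sum.elim F fun i => gluePerm (T i) (U i)
  let J : (A ⊕ B) × Bool → (A ⊕ B) × Bool := fun p => (p.1, !p.2)
  have hJ : ∀ x, J x ≠ x := fun x h => by simpa [J] using congrArg Prod.snd h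
  have hJJ : ∀ x, J (J x) = x := fun x => Prod.ext rfl (Bool.not_not _)
  have hJne : ∀ x y, x ≠ y → y ≠ J x → x.1 ≠ y.1 := by
    rintro ⟨x, s⟩ ⟨y, t⟩ h1 h2 (rfl : x = y)
    rcases eq_or_ne t s with rfl | hst
    · exact h1 rfl
    · exact h2 (Prod.ext rfl (Bool.eq_not.2 hst))
  have hcov : ∀ x y, x ≠ y → y ≠ J x → ∃ i, Joins (σ i) x y := by
    intro x y h1 h2
    have hne := hJne x y h1 h2
    obtain ⟨a | b, s⟩ := x <;> obtain ⟨a' | b', t⟩ := y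
    · obtain ⟨j, hj⟩ := hAA a a' s t (by simpa using hne)
      exact ⟨Sum.inr j, (joins_gluePerm_inl _ _ _ _ _ _).2 hj⟩
    · obtain ⟨i, hi⟩ := hAB a b' s t
      exact ⟨Sum.inl i, hi⟩
    · obtain ⟨i, hi⟩ := hAB a' b t s
      exact ⟨Sum.inl i, hi.symm⟩
    · rcases hBB b b' s t (by simpa using hne) with ⟨i, hi⟩ | ⟨j, hj⟩
      · exact ⟨Sum.inl i, hi⟩
      · exact ⟨Sum.inr j, (joins_gluePerm_inr _ _ _ _ _ _).2 hj⟩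
  obtain ⟨hle, huniq⟩ := joins_unique_of_cover σ J hJ (by
    simp only [Fintype.card_sum, Fintype.card_fin, hcardV]; omega) hcov
  let I : SimpleGraph (Fin v) :=
    { Adj := fun x y => y = e (J (e.symm x))
      symm := ⟨fun x y h => by subst h; simp [hJJ]⟩
      loopless := ⟨fun x h => hJ (e.symm x) (by
        have := congrArg e.symm h
        rw [Equiv.symm_apply_apply] at this
        exact this.symm)⟩ }
  have hI : ∀ x y, I.Adj (e x) (e y) ↔ y = J x := fun x y => by
    change e y = e (J (e.symm (e x))) ↔ _
    simp
  have hK : ∀ x y, (⊤ \ I : SimpleGraph (Fin v)).Adj (e x) (e y) ↔ x ≠ y ∧ y ≠ J x :=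
    fun x y => by simp [hI]
  have hGF : ∀ i x y, (permGraph (e.permCongr (F i))).Adj (e x) (e y) ↔ Joins (F i) x y := by
    intro i x y
    rw [permGraph_adj hk, joins_permCongr]
    intro z
    rw [← e.apply_symm_apply z, minimalPeriod_permCongr, hF]
  have hpT : ∀ i x, minimalPeriod (eA.permCongr (T i)) x = k := by
    intro i z
    rw [← eA.apply_symm_apply z, minimalPeriod_permCongr, hT]
  have hpU : ∀ i x, minimalPeriod (eB.permCongr (U i)) x = k := by
    intro i z
    rw [← eB.apply_symm_apply z, minimalPeriod_permCongr, hU]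
  have hpF : ∀ i x, minimalPeriod (e.permCongr (F i)) x = k := by
    intro i z
    rw [← e.apply_symm_apply z, minimalPeriod_permCongr, hF]
  have hGT : ∀ i x y, (permGraph (eA.permCongr (T i))).Adj (eA x) (eA y) ↔ Joins (T i) x y :=
    fun i x y => by rw [permGraph_adj hk (hpT i), joins_permCongr]
  have hGU : ∀ i x y, (permGraph (eB.permCongr (U i))).Adj (eB x) (eB y) ↔ Joins (U i) x y :=
    fun i x y => by rw [permGraph_adj hk (hpU i), joins_permCongr]
  have hglue : ∀ i x y, (glue (permGraph (eA.permCongr (T i)))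
      (permGraph (eB.permCongr (U i)))).Adj (e x) (e y) ↔ Joins (gluePerm (T i) (U i)) x y := by
    intro i x y
    rw [glue, SimpleGraph.sup_adj, SimpleGraph.map_adj, SimpleGraph.map_adj]
    constructor
    · rintro (⟨u, w, h, h1, h2⟩ | ⟨u, w, h, h1, h2⟩)
      · obtain ⟨⟨a, s⟩, rfl⟩ := eA.surjective u
        obtain ⟨⟨b, t⟩, rfl⟩ := eA.surjective w
        rw [hGT] at h
        obtain rfl := e.injective h1
        obtain rfl := e.injective h2
        exact (joins_gluePerm_inl _ _ _ _ _ _).2 h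
      · obtain ⟨⟨a, s⟩, rfl⟩ := eB.surjective u
        obtain ⟨⟨b, t⟩, rfl⟩ := eB.surjective w
        rw [hGU] at h
        obtain rfl := e.injective h1
        obtain rfl := e.injective h2
        exact (joins_gluePerm_inr _ _ _ _ _ _).2 h
    · intro h
      obtain ⟨a | b, s⟩ := x <;> obtain ⟨a' | b', t⟩ := y
      · rw [joins_gluePerm_inl] at h
        exact Or.inl ⟨_, _, (hGT i _ _).2 h, rfl, rfl⟩
      · exact absurd h (not_joins_gluePerm_inl_inr _ _ _ _ _ _)
      · exact absurd h.symm (not_joins_gluePerm_inl_inr _ _ _ _ _ _)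
      · rw [joins_gluePerm_inr] at h
        exact Or.inr ⟨_, _, (hGU i _ _).2 h, rfl, rfl⟩
  have hGσ : ∀ i x y, (Sum.elim (fun i => permGraph (e.permCongr (F i)))
      (fun i => glue (permGraph (eA.permCongr (T i))) (permGraph (eB.permCongr (U i)))) i).Adj
      (e x) (e y) ↔ Joins (σ i) x y := by
    rintro (i | i) x y
    · exact hGF i x y
    · exact hglue i x y
  have heven : Even v := ⟨_, by rw [hv, two_mul]⟩
  have hevenm : Even m := ⟨_, by rw [hm, two_mul]⟩
  have hcM : Nat.card M = m := by
    rw [← Nat.card_congr eA]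
    simp [hm, mul_comm]
  exact ⟨{
    K := ⊤ \ I
    isKStar_K := by
      refine ⟨fun h => ?_, fun _ => ⟨I, fun x => ⟨_, rfl, fun _ h => h⟩, rfl⟩⟩
      rw [Nat.card_fin] at h
      exact absurd heven (Nat.not_even_iff_odd.2 h)
    M := M
    card_M := hcM
    -- The partner map `J` fixes the base point, so `I` restricts to a 1-factor of `M` and the whole
    -- induced graph is a valid copy of `K_m^*`.
    L := (⊤ \ I : SimpleGraph (Fin v)).induce M
    isKStar_L := by
      refine ⟨fun h => ?_, fun _ => ⟨I.induce M, fun x => ?_, ?_⟩⟩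
      · rw [hcM] at h
        exact absurd hevenm (Nat.not_even_iff_odd.2 h)
      · obtain ⟨⟨a, s⟩, rfl⟩ := eA.surjective x
        refine ⟨eA (a, !s), (hI (Sum.inl a, s) (Sum.inl a, !s)).2 rfl, fun y hy => ?_⟩
        obtain ⟨⟨b, t⟩, rfl⟩ := eA.surjective y
        have := (hI (Sum.inl a, s) (Sum.inl b, t)).1 hy
        simpa [J] using this
      · ext x y
        simp [Subtype.ext_iff]
    L_le := le_rfl
    le_L := fun _ _ => le_rfl
    F := fun i => permGraph (e.permCongr (F i))
    T := fun i => permGraph (eA.permCongr (T i))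
    U := fun i => permGraph (eB.permCongr (U i))
    isTwoRegular_F := fun i => isTwoRegular_permGraph hk (hpF i)
    isTwoRegular_T := fun i => isTwoRegular_permGraph hk (hpT i)
    isTwoRegular_U := fun i => isTwoRegular_permGraph hk (hpU i)
    uniform_F := fun i => isUniformCycles_permGraph hk (hpF i)
    uniform_T := fun i => isUniformCycles_permGraph hk (hpT i)
    uniform_U := fun i => isUniformCycles_permGraph hk (hpU i)
    isFactorization_T := by
      constructor
      · intro i x y h
        obtain ⟨⟨a, s⟩, rfl⟩ := eA.surjective x
        obtain ⟨⟨b, t⟩, rfl⟩ := eA.surjective y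
        rw [hGT] at h
        exact (hK _ _).2 (hle (Sum.inr i) _ _ ((joins_gluePerm_inl _ _ _ _ _ _).2 h))
      · intro x y h
        obtain ⟨⟨a, s⟩, rfl⟩ := eA.surjective x
        obtain ⟨⟨b, t⟩, rfl⟩ := eA.surjective y
        have hne := (hK (Sum.inl a, s) (Sum.inl b, t)).1 h
        obtain ⟨j, hj⟩ := hAA a b s t (by simpa using hJne _ _ hne.1 hne.2)
        refine ⟨j, (hGT _ _ _).2 hj, fun i hi => ?_⟩
        have hi := (hGT _ _ _).1 hi
        exact Sum.inr_injective (huniq _ _ (Sum.inr i) (Sum.inr j)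
          ((joins_gluePerm_inl _ _ _ _ _ _).2 hi) ((joins_gluePerm_inl _ _ _ _ _ _).2 hj))
    isFactorization := by
      constructor
      · intro i x y h
        obtain ⟨x, rfl⟩ := e.surjective x
        obtain ⟨y, rfl⟩ := e.surjective y
        exact (hK _ _).2 (hle i _ _ ((hGσ _ _ _).1 h))
      · intro x y h
        obtain ⟨x, rfl⟩ := e.surjective x
        obtain ⟨y, rfl⟩ := e.surjective y
        have hne := (hK _ _).1 h
        obtain ⟨j, hj⟩ := hcov x y hne.1 hne.2
        exact ⟨j, (hGσ _ _ _).2 hj, fun i hi => huniq _ _ _ _ ((hGσ _ _ _).1 hi) hj⟩ }⟩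

/-! ### Necessity -/

theorem two_mul_le_of_UMSF {v m k : ℕ} (hv : Even v) (hm : Even m) (hlt : m < v)
    (S : UMSF v m k) : 2 * m ≤ v := by
  classical
  obtain ⟨I, hI, hKI⟩ := S.isKStar_K.2 (by rwa [Nat.card_fin])
  obtain ⟨J, hJ, hLJ⟩ := S.isKStar_L.2 (by rwa [S.card_M])
  obtain ⟨x, hx⟩ : ∃ x, x ∉ S.M := by
    by_contra! h
    have : S.M = Set.univ := Set.eq_univ_of_forall h
    have hc := S.card_M
    rw [this, Nat.card_univ, Nat.card_fin] at hc
    omega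
  -- The missing 1-factor of `L` already matches `y` inside `M`, and it is part of the one missing
  -- from `K`; hence `y` is not matched with `x`.
  have hadj : ∀ y : S.M, S.K.Adj x y := by
    intro y
    have hxy : x ≠ y := fun h => hx (h ▸ y.2)
    rw [hKI, SimpleGraph.sdiff_adj]
    refine ⟨hxy, fun hIx => ?_⟩
    obtain ⟨z, hz, -⟩ := hJ y
    have h1 : ¬ S.L.Adj y z := by rw [hLJ]; simp [hz]
    have h2 : ¬ S.K.Adj y z := fun h => h1 (S.le_L hv hm h)
    have hyz : (y : Fin v) ≠ z := fun h => hz.ne (Subtype.ext h)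
    have h3 : I.Adj y z := by
      by_contra h
      exact h2 (by rw [hKI, SimpleGraph.sdiff_adj]; exact ⟨hyz, h⟩)
    have := (hI y).unique h3 hIx.symm
    exact hx (this ▸ z.2)
  have hF : ∀ y : S.M, ∃ i, (S.F i).Adj x y := by
    intro y
    obtain ⟨i | i, hi, -⟩ := S.isFactorization.2 x y (hadj y)
    · exact ⟨i, hi⟩
    · exfalso
      rw [Sum.elim_inr, glue, SimpleGraph.sup_adj, SimpleGraph.map_adj, SimpleGraph.map_adj] at hi
      rcases hi with ⟨u, w, -, h1, h2⟩ | ⟨u, w, -, h1, h2⟩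
      · exact hx (h1 ▸ u.2)
      · exact w.2 ((show (w : Fin v) = y from h2) ▸ y.2)
  choose f hf using hF
  let g : S.M → Σ i, (S.F i).neighborSet x := fun y => ⟨f y, ⟨y, hf y⟩⟩
  have hg : Injective g := by
    intro y z h
    have : ((g y).2 : Fin v) = (g z).2 := by rw [h]
    exact Subtype.ext this
  have hcard := Nat.card_le_card_of_injective g hg
  rw [S.card_M, Nat.card_sigma] at hcard
  have : ∀ i, Nat.card ((S.F i).neighborSet x) = 2 := fun i => S.isTwoRegular_F i x
  simp only [this, Finset.sum_const, Finset.card_univ, Fintype.card_fin, smul_eq_mul] at hcard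
  obtain ⟨a, rfl⟩ := hv
  obtain ⟨b, rfl⟩ := hm
  omega

/-! ### Doubling a 2-factor -/

/-- There is a map to `ZMod h` that increases by one along the permutation `τ`: each cycle of `τ`
has a length divisible by `h`. -/
def HasLevel {V : Type*} (h : ℕ) (τ : Perm V) : Prop :=
  ∃ p : V → ZMod h, ∀ x, p (τ x) = p x + 1

theorem HasLevel.permCongr {V W : Type*} {h : ℕ} {τ : Perm V} (hτ : HasLevel h τ) (e : V ≃ W) :
    HasLevel h (e.permCongr τ) := by
  obtain ⟨p, hp⟩ := hτ
  exact ⟨fun x => p (e.symm x), fun x => by simp [Equiv.permCongr_apply, hp]⟩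

section
variable {V : Type*} {h : ℕ} (τ : Perm V) (p : V → ZMod h)

/-- A permutation of `V × Bool` whose cycles run along `τ` from one vertex of level zero to the
next, and return. -/
def foldPerm (hp : ∀ x, p (τ x) = p x + 1) : Perm (V × Bool) where
  toFun y := match y with
    | (x, false) => if p x = -1 then (τ x, true) else (τ x, false)
    | (x, true) => if p x = 1 then (τ.symm x, false) else (τ.symm x, true)
  invFun y := match y with
    | (x, false) => if p x = 0 then (τ x, true) else (τ.symm x, false)
    | (x, true) => if p x = 0 then (τ.symm x, false) else (τ x, true)
  left_inv := by
    have hp' : ∀ x, p (τ.symm x) = p x - 1 := fun x => by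
      have := hp (τ.symm x)
      rw [τ.apply_symm_apply] at this
      rw [this]; ring
    rintro ⟨x, _ | _⟩
    · by_cases hx : p x = -1
      · simp [hx, hp]
      · have : p x + 1 ≠ 0 := fun h => hx (eq_neg_of_add_eq_zero_left h)
        simp [hx, hp, this]
    · by_cases hx : p x = 1
      · simp [hx, hp']
      · have : p x - 1 ≠ 0 := fun h => hx (sub_eq_zero.1 h)
        simp [hx, hp', this]
  right_inv := by
    have hp' : ∀ x, p (τ.symm x) = p x - 1 := fun x => by
      have := hp (τ.symm x)
      rw [τ.apply_symm_apply] at this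
      rw [this]; ring
    rintro ⟨x, _ | _⟩
    · by_cases hx : p x = 0
      · simp [hx, hp]
      · have : p x - 1 ≠ -1 := fun h => hx (by linear_combination h)
        simp [hx, hp', this]
    · by_cases hx : p x = 0
      · simp [hx, hp']
      · have : p x + 1 ≠ 1 := fun h => hx (by linear_combination h)
        simp [hx, hp, this]

variable (hp : ∀ x, p (τ x) = p x + 1)
include hp

theorem foldPerm_false (x : V) :
    foldPerm τ p hp (x, false) = if p x = -1 then (τ x, true) else (τ x, false) := rfl

theorem foldPerm_true (x : V) :
    foldPerm τ p hp (x, true) = if p x = 1 then (τ.symm x, false) else (τ.symm x, true) := rfl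

theorem level_iterate (j : ℕ) (x : V) : p (τ^[j] x) = p x + j := by
  induction j with
  | zero => simp
  | succ j ih => rw [iterate_succ_apply', hp, ih]; push_cast; ring

/-- With the next lemma this lists a whole cycle: `x, τ x, …, τ^(h-1) x` on the layer `false`, then
`τ^h x, …, τ x` on the layer `true`, then `x` again. -/
theorem foldPerm_iterate_up (x : V) (hx : p x = 0) (j : ℕ) (hj : j < h) :
    (foldPerm τ p hp)^[j] (x, false) = (τ^[j] x, false) := by
  induction j with
  | zero => rfl
  | succ j ih =>
    rw [iterate_succ_apply', ih (by omega), foldPerm_false, if_neg, iterate_succ_apply']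
    rw [level_iterate τ p hp, hx, zero_add]
    intro h1
    have : ((j + 1 : ℕ) : ZMod h) = 0 := by push_cast; rw [h1]; ring
    rw [ZMod.natCast_eq_zero_iff] at this
    exact absurd (Nat.le_of_dvd (by omega) this) (by omega)

theorem foldPerm_iterate_down (hh : 0 < h) (x : V) (hx : p x = 0) (j : ℕ) (hj : j < h) :
    (foldPerm τ p hp)^[h + j] (x, false) = (τ^[h - j] x, true) := by
  induction j with
  | zero =>
    obtain ⟨i, rfl⟩ : ∃ i, h = i + 1 := ⟨h - 1, by omega⟩
    rw [add_zero, iterate_succ_apply', foldPerm_iterate_up τ p hp x hx i (by omega),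
      foldPerm_false, if_pos, Nat.sub_zero, iterate_succ_apply']
    rw [level_iterate τ p hp, hx, zero_add]
    have : ((i + 1 : ℕ) : ZMod (i + 1)) = 0 := ZMod.natCast_self _
    push_cast at this
    exact eq_neg_of_add_eq_zero_left this
  | succ j ih =>
    rw [← add_assoc, iterate_succ_apply', ih (by omega), foldPerm_true, if_neg]
    · obtain ⟨i, hi⟩ : ∃ i, h - j = i + 1 := ⟨h - j - 1, by omega⟩
      rw [hi, show h - (j + 1) = i by omega, iterate_succ_apply', τ.symm_apply_apply]
    · rw [level_iterate τ p hp, hx, zero_add, Nat.cast_sub (by omega), ZMod.natCast_self]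
      intro h1
      have : ((j + 1 : ℕ) : ZMod h) = 0 := by push_cast; linear_combination -h1
      rw [ZMod.natCast_eq_zero_iff] at this
      exact absurd (Nat.le_of_dvd (by omega) this) (by omega)

/-- No shorter period is possible: after `0 < d < h` steps the level is not zero, and from `h` to `2
* h - 1` steps the layer is `true`. -/
theorem minimalPeriod_foldPerm_of_level_zero (hh : 2 ≤ h) (x : V) (hx : p x = 0) :
    minimalPeriod (foldPerm τ p hp) (x, false) = 2 * h := by
  have hper : IsPeriodicPt (foldPerm τ p hp) (2 * h) (x, false) := by
    have h1 := foldPerm_iterate_down τ p hp (by omega) x hx (h - 1) (by omega)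
    have h2 : 2 * h = (h + (h - 1)) + 1 := by omega
    rw [IsPeriodicPt, IsFixedPt, h2, iterate_succ_apply', h1, show h - (h - 1) = 1 by omega,
      foldPerm_true, if_pos, iterate_one, τ.symm_apply_apply]
    rw [iterate_one, hp, hx, zero_add]
  refine le_antisymm (hper.minimalPeriod_le (by omega)) (not_lt.1 fun hlt => ?_)
  have hpos := hper.minimalPeriod_pos (by omega)
  have hfix := isPeriodicPt_minimalPeriod (foldPerm τ p hp) (x, false)
  generalize minimalPeriod (foldPerm τ p hp) (x, false) = d at *
  rw [IsPeriodicPt, IsFixedPt] at hfix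
  rcases lt_or_ge d h with hd | hd
  · rw [foldPerm_iterate_up τ p hp x hx d hd] at hfix
    have := congrArg p (congrArg Prod.fst hfix)
    simp only [level_iterate τ p hp, hx, zero_add, ZMod.natCast_eq_zero_iff] at this
    exact absurd (Nat.le_of_dvd hpos this) (by omega)
  · obtain ⟨j, rfl⟩ := Nat.exists_eq_add_of_le hd
    rw [foldPerm_iterate_down τ p hp (by omega) x hx j (by omega)] at hfix
    simpa using congrArg Prod.snd hfix

theorem minimalPeriod_foldPerm (hh : 2 ≤ h) (y : V × Bool) :
    minimalPeriod (foldPerm τ p hp) y = 2 * h := by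
  have : NeZero h := ⟨by omega⟩
  have key : ∃ x i, p x = 0 ∧ (foldPerm τ p hp)^[i] (x, false) = y := by
    have hsymm : ∀ (j : ℕ) z, τ^[j] (τ.symm^[j] z) = z := fun j z =>
      (LeftInverse.iterate (fun z => τ.apply_symm_apply z) j) z
    have hlev : ∀ (j : ℕ) z, p (τ.symm^[j] z) = p z - j := fun j z => by
      have := level_iterate τ p hp j (τ.symm^[j] z)
      rw [hsymm] at this
      rw [this]; ring
    obtain ⟨z, _ | _⟩ := y
    · refine ⟨τ.symm^[(p z).val] z, (p z).val, ?_, ?_⟩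
      · rw [hlev]; simp
      · rw [foldPerm_iterate_up τ p hp _ (by rw [hlev]; simp) _ (ZMod.val_lt _), hsymm]
    -- On the layer `true` the exponents run from `h` down to `1`, so level zero is represented by
    -- `h` and not by `0`.
    · obtain ⟨r, hr0, hr1, hr⟩ : ∃ r : ℕ, 0 < r ∧ r ≤ h ∧ (r : ZMod h) = p z := by
        rcases Nat.eq_zero_or_pos (p z).val with h0 | h0
        · exact ⟨h, by omega, le_rfl, by rw [ZMod.natCast_self, (ZMod.val_eq_zero _).1 h0]⟩
        · exact ⟨(p z).val, h0, (ZMod.val_lt _).le, by simp⟩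
      have hx : p (τ.symm^[r] z) = 0 := by rw [hlev, hr, sub_self]
      refine ⟨τ.symm^[r] z, h + (h - r), hx, ?_⟩
      rw [foldPerm_iterate_down τ p hp (by omega) _ hx _ (by omega), show h - (h - r) = r by omega,
        hsymm]
  obtain ⟨x, i, hx, rfl⟩ := key
  have hx' := minimalPeriod_foldPerm_of_level_zero τ p hp hh x hx
  rw [minimalPeriod_apply_iterate, hx']
  exact minimalPeriod_pos_iff_mem_periodicPts.1 (by omega)

/-- The condition selects two of the four lifts of a step of `τ`: both lifts into the turning point
`(τ x, true)` at level `-1`, both lifts out of `(x, false)` at level `0`, and the two parallel lifts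
elsewhere. -/
theorem joins_foldPerm (hh : 2 ≤ h) (x : V) (a b : Bool) (hab : (p x = -1 → b = true) ∧
    (p x = 0 → a = false) ∧ (p x ≠ -1 → p x ≠ 0 → a = b)) :
    Joins (foldPerm τ p hp) (x, a) (τ x, b) := by
  have : Fact (1 < h) := ⟨hh⟩
  obtain ⟨h1, h2, h3⟩ := hab
  by_cases hx : p x = -1
  · obtain rfl := h1 hx
    cases a
    · left; rw [foldPerm_false, if_pos hx]
    · right
      rw [foldPerm_true, if_neg, τ.symm_apply_apply]
      rw [hp, hx]
      simp
  by_cases hx0 : p x = 0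
  · obtain rfl := h2 hx0
    cases b
    · left; rw [foldPerm_false, if_neg hx]
    · right
      rw [foldPerm_true, if_pos, τ.symm_apply_apply]
      rw [hp, hx0, zero_add]
  obtain rfl := h3 hx hx0
  cases a
  · left; rw [foldPerm_false, if_neg hx]
  · right
    rw [foldPerm_true, if_neg, τ.symm_apply_apply]
    rw [hp]
    simpa using hx0

end

/-- A permutation with cycle lengths divisible by `h` yields two permutations of the doubled
vertex set, with all cycles of length `2 * h`, that cover the doubled edges. -/
theorem HasLevel.exists_double {V : Type*} {h : ℕ} (hh : 2 ≤ h) {τ : Perm V}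
    (hτ : HasLevel h τ) : ∃ σ : Bool → Perm (V × Bool),
      (∀ c y, minimalPeriod (σ c) y = 2 * h) ∧
      ∀ x y a b, Joins τ x y → ∃ c, Joins (σ c) (x, a) (y, b) := by
  obtain ⟨p, hp⟩ := hτ
  have : Fact (1 < h) := ⟨hh⟩
  -- Exchanging the layers where `c` holds must turn the selected lifts into the other two. For this
  -- `c 0` has to be true, and `c` has to alternate along `1, …, h - 1`; nothing relates `c 0` to
  -- its neighbours, so `h` may have either parity.
  let c : ZMod h → Bool := fun r => decide (r = 0 ∨ Odd r.val)
  let φ : V × Bool ≃ V × Bool :=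
    { toFun := fun y => (y.1, xor y.2 (c (p y.1)))
      invFun := fun y => (y.1, xor y.2 (c (p y.1)))
      left_inv := fun y => by simp
      right_inv := fun y => by simp }
  refine ⟨fun d => cond d (φ.permCongr (foldPerm τ p hp)) (foldPerm τ p hp), ?_, ?_⟩
  · rintro (_ | _) y
    · exact minimalPeriod_foldPerm τ p hp hh y
    · change minimalPeriod (φ.permCongr (foldPerm τ p hp)) y = _
      rw [← φ.apply_symm_apply y, minimalPeriod_permCongr, minimalPeriod_foldPerm τ p hp hh]
  · have key : ∀ x a b, ∃ d, Joins (cond d (φ.permCongr (foldPerm τ p hp)) (foldPerm τ p hp))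
        (x, a) (τ x, b) := by
      intro x a b
      have hφ : ∀ x a, (x, a) = φ (x, xor a (c (p x))) := fun x a => by simp [φ]
      have hne : (-1 : ZMod h) ≠ 0 := by simp
      by_cases hx : p x = -1
      · cases b
        · refine ⟨true, ?_⟩
          rw [hφ x a, hφ (τ x) false, cond_true, joins_permCongr]
          refine joins_foldPerm τ p hp hh x _ _ ⟨fun _ => ?_, fun h => absurd (hx ▸ h) hne,
            fun h => absurd hx h⟩
          simp [c, hp, hx]
        · exact ⟨false, joins_foldPerm τ p hp hh x _ _ ⟨fun _ => rfl,
            fun h => absurd (hx ▸ h) hne, fun h => absurd hx h⟩⟩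
      by_cases hx0 : p x = 0
      · cases a
        · exact ⟨false, joins_foldPerm τ p hp hh x _ _ ⟨fun h => absurd h hx, fun _ => rfl,
            fun _ h => absurd hx0 h⟩⟩
        · refine ⟨true, ?_⟩
          rw [hφ x true, hφ (τ x) b, cond_true, joins_permCongr]
          refine joins_foldPerm τ p hp hh x _ _ ⟨fun h => absurd h hx, fun _ => ?_,
            fun _ h => absurd hx0 h⟩
          simp [c, hx0]
      by_cases hab : a = b
      · exact ⟨false, joins_foldPerm τ p hp hh x _ _ ⟨fun h => absurd h hx,
          fun h => absurd h hx0, fun _ _ => hab⟩⟩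
      · refine ⟨true, ?_⟩
        rw [hφ x a, hφ (τ x) b, cond_true, joins_permCongr]
        refine joins_foldPerm τ p hp hh x _ _ ⟨fun h => absurd h hx,
            fun h => absurd h hx0, fun _ _ => ?_⟩
        have h1 : p x + 1 ≠ 0 := fun h => hx (eq_neg_of_add_eq_zero_left h)
        have hv : (p x + 1).val = (p x).val + 1 := by
          rw [ZMod.val_add_of_lt, ZMod.val_one]
          rw [ZMod.val_one]
          have hlt := ZMod.val_lt (p x)
          by_contra hge
          apply h1
          rw [← ZMod.natCast_zmod_val (p x), show (p x).val = h - 1 by omega,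
            Nat.cast_sub (by omega)]
          simp
        have hc : c (p (τ x)) = !c (p x) := by
          simp only [c, hp, h1, hx0, hv, Nat.odd_add_one, false_or, decide_not]
        rw [hc]
        revert hab
        cases a <;> cases b <;> cases c (p x) <;> simp
    rintro x y a b (rfl | rfl)
    · exact key x a b
    · obtain ⟨d, hd⟩ := key y b a
      exact ⟨d, hd.symm⟩

/-! ### Zigzags, Walecki cycles and mixed differences -/

/-- `N` permutations with cycle lengths divisible by `h` join all the pairs in `R`. -/
def LevelCover {V : Type*} (h N : ℕ) (R : V → V → Prop) : Prop :=
  ∃ U : Fin N → Perm V, (∀ j, HasLevel h (U j)) ∧ ∀ x y, R x y → ∃ j, Joins (U j) x y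

theorem LevelCover.add {V : Type*} {h N N' : ℕ} {R R' : V → V → Prop} (hR : LevelCover h N R)
    (hR' : LevelCover h N' R') : LevelCover h (N + N') fun x y => R x y ∨ R' x y := by
  obtain ⟨U, h1, h2⟩ := hR
  obtain ⟨U', h1', h2'⟩ := hR'
  refine ⟨Fin.append U U', fun j => ?_, fun x y hxy => ?_⟩
  · induction j using Fin.addCases with
    | left j => rw [Fin.append_left]; exact h1 j
    | right j => rw [Fin.append_right]; exact h1' j
  · rcases hxy with hxy | hxy
    · obtain ⟨j, hj⟩ := h2 x y hxy
      exact ⟨Fin.castAdd _ j, by rwa [Fin.append_left]⟩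
    · obtain ⟨j, hj⟩ := h2' x y hxy
      exact ⟨Fin.natAdd _ j, by rwa [Fin.append_right]⟩

/-- A listing of a finite type as a cycle gives a cyclic permutation. -/
theorem exists_perm_of_cycle {V : Type*} [Fintype V] {h L : ℕ} (hL : 0 < L) (hhL : h ∣ L)
    (hcard : Fintype.card V = L) (c : ℕ → V) (hc : ∀ v, ∃ j < L, c j = v) :
    ∃ τ : Perm V, HasLevel h τ ∧ (∀ j, j + 1 < L → Joins τ (c j) (c (j + 1))) ∧
      Joins τ (c (L - 1)) (c 0) := by
  have : NeZero L := ⟨hL.ne'⟩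
  let f : ZMod L → V := fun z => c z.val
  have hf : Bijective f := by
    rw [Fintype.bijective_iff_surjective_and_card, ZMod.card, hcard]
    refine ⟨fun v => ?_, rfl⟩
    obtain ⟨j, hj, rfl⟩ := hc v
    exact ⟨j, by simp only [f]; rw [ZMod.val_cast_of_lt hj]⟩
  let e : ZMod L ≃ V := Equiv.ofBijective f hf
  have he : ∀ j < L, e (j : ZMod L) = c j := fun j hj => by
    change c (ZMod.val (j : ZMod L)) = c j
    rw [ZMod.val_cast_of_lt hj]
  have hstep : ∀ z, Joins (e.permCongr (Equiv.addRight (1 : ZMod L))) (e z) (e (z + 1)) :=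
    fun z => (joins_permCongr _ _ _ _).2 (Or.inl rfl)
  -- As `h ∣ L`, the position in the cycle modulo `h` is a level.
  refine ⟨e.permCongr (Equiv.addRight (1 : ZMod L)), HasLevel.permCongr
    ⟨ZMod.castHom hhL (ZMod h), fun z => by rw [Equiv.coe_addRight, map_add, map_one]⟩ e, fun j hj => ?_, ?_⟩
  · have := hstep j
    rwa [he j (by omega), ← Nat.cast_succ, he _ hj] at this
  · have := hstep (L - 1 : ℕ)
    rwa [he _ (by omega), ← Nat.cast_succ, Nat.succ_eq_add_one, Nat.sub_add_cancel hL,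
      ZMod.natCast_self, ← Nat.cast_zero, he _ hL] at this

/-- The zigzag `0, -a, -1, 1 - a, -2, …`, whose steps have the lengths `a, a - 1, a - 2, …`. -/
def zigzag (a i : ℕ) : ℤ := if i % 2 = 0 then -(i / 2 : ℕ) else (i / 2 : ℕ) - (a : ℤ)

theorem zigzag_even (a i : ℕ) : zigzag a (2 * i) = -(i : ℤ) := by
  rw [zigzag, if_pos (by omega), show 2 * i / 2 = i by omega]

theorem zigzag_odd (a i : ℕ) : zigzag a (2 * i + 1) = i - (a : ℤ) := by
  rw [zigzag, if_neg (by omega), show (2 * i + 1) / 2 = i by omega]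

theorem exists_zigzag_eq (a s : ℕ) (hs : s ≤ a) : ∃ i ≤ a, zigzag a i = -(s : ℤ) := by
  rcases le_or_gt (2 * s) a with h | h
  · exact ⟨2 * s, h, zigzag_even a s⟩
  · exact ⟨2 * (a - s) + 1, by omega, by rw [zigzag_odd]; omega⟩

theorem zigzag_sub (a i : ℕ) : zigzag a (i + 1) - zigzag a i = a - (i : ℤ) ∨
    zigzag a (i + 1) - zigzag a i = -(a - (i : ℤ)) := by
  obtain ⟨j, rfl | rfl⟩ := Nat.even_or_odd' i
  · rw [zigzag_odd, zigzag_even]; right; push_cast; ring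
  · rw [show 2 * j + 1 + 1 = 2 * (j + 1) by ring, zigzag_odd, zigzag_even]
    left; push_cast; ring

/-- Each pair of different elements of `ZMod (2 * r)` is a step of one of the `r` first
translates of the zigzag. -/
theorem exists_zigzag_step (r : ℕ) (x y : ZMod (2 * r)) (hxy : x ≠ y) (hr : 0 < r) :
    ∃ j < r, ∃ i, i + 1 < 2 * r ∧
      (x = zigzag (2 * r - 1) i + (j : ℕ) ∧ y = zigzag (2 * r - 1) (i + 1) + (j : ℕ) ∨
       y = zigzag (2 * r - 1) i + (j : ℕ) ∧ x = zigzag (2 * r - 1) (i + 1) + (j : ℕ)) := by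
  have : NeZero (2 * r) := ⟨by omega⟩
  have h2r : (2 * r : ZMod (2 * r)) = 0 := by
    have := ZMod.natCast_self (2 * r)
    push_cast at this
    exact this
  have ho : ∀ i : ℕ, (zigzag (2 * r - 1) (2 * i + 1) : ZMod (2 * r)) = i + 1 := fun i => by
    rw [zigzag_odd, Nat.cast_sub (by omega)]
    push_cast
    linear_combination -h2r
  have he : ∀ i : ℕ, (zigzag (2 * r - 1) (2 * i) : ZMod (2 * r)) = -i := fun i => by
    rw [zigzag_even]
    push_cast
    rfl
  -- Modulo `2 * r` the zigzag is `0, 1, -1, 2, -2, …`, with consecutive sums alternately `1` and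
  -- `0`. In the translate by `j` the sums are `2 * j + 1` and `2 * j`, so `x + y` determines `j`
  -- and the parity of the step, and `j - x` its position.
  obtain ⟨s, hs, hsum⟩ : ∃ s < 2 * r, (s : ZMod (2 * r)) = x + y :=
    ⟨(x + y).val, ZMod.val_lt _, by simp⟩
  refine ⟨s / 2, by omega, ?_⟩
  obtain ⟨u, hu, hux⟩ : ∃ u < 2 * r, (u : ZMod (2 * r)) = (s / 2 : ℕ) - x :=
    ⟨((s / 2 : ℕ) - x : ZMod (2 * r)).val, ZMod.val_lt _, by simp⟩
  generalize hj : s / 2 = j at *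
  rcases Nat.mod_two_eq_zero_or_one s with hs2 | hs2
  · obtain rfl : s = 2 * j := by omega
    push_cast at hsum
    rcases lt_trichotomy u r with h | h | h
    · rcases Nat.eq_zero_or_pos u with rfl | hu0
      -- Here `y = x + 2 * u`, so `u = 0`, like `u = r` below, would force `x = y`.
      · exfalso; apply hxy; push_cast at hux; linear_combination hsum + 2 * hux
      · obtain ⟨i, rfl⟩ : ∃ i, u = i + 1 := ⟨u - 1, by omega⟩
        refine ⟨2 * i + 1, by omega, Or.inr ?_⟩
        rw [ho, show 2 * i + 1 + 1 = 2 * (i + 1) by ring, he]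
        push_cast at hux ⊢
        constructor
        · linear_combination -hux - hsum
        · linear_combination hux
    · exfalso; apply hxy; subst h; linear_combination hsum + 2 * hux - h2r
    · obtain ⟨i, hi⟩ : ∃ i, u + i + 1 = 2 * r := ⟨2 * r - u - 1, by omega⟩
      have hui : (u : ZMod (2 * r)) + i + 1 = 0 := by
        have := congrArg (Nat.cast (R := ZMod (2 * r))) hi
        push_cast at this
        rw [this, h2r]
      refine ⟨2 * i + 1, by omega, Or.inl ?_⟩
      rw [ho, show 2 * i + 1 + 1 = 2 * (i + 1) by ring, he]
      push_cast
      constructor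
      · linear_combination hux - hui
      · linear_combination -hux - hsum + hui
  · obtain rfl : s = 2 * j + 1 := by omega
    push_cast at hsum
    rcases lt_or_ge u r with h | h
    · refine ⟨2 * u, by omega, Or.inl ?_⟩
      rw [ho, he]
      constructor
      · linear_combination hux
      · linear_combination -hux - hsum
    · obtain ⟨i, hi⟩ : ∃ i, u + i + 1 = 2 * r := ⟨2 * r - u - 1, by omega⟩
      have hui : (u : ZMod (2 * r)) + i + 1 = 0 := by
        have := congrArg (Nat.cast (R := ZMod (2 * r))) hi
        push_cast at this
        rw [this, h2r]
      refine ⟨2 * i, by omega, Or.inr ?_⟩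
      rw [ho, he]
      constructor
      · linear_combination -hux - hsum + hui
      · linear_combination hux - hui

theorem exists_zigzag_cast_eq (r : ℕ) (hr : 0 < r) (x : ZMod (2 * r)) :
    ∃ i < 2 * r, (zigzag (2 * r - 1) i : ZMod (2 * r)) = x := by
  have : NeZero (2 * r) := ⟨by omega⟩
  have hlt := ZMod.val_lt (-x)
  obtain ⟨i, hi, h⟩ := exists_zigzag_eq (2 * r - 1) (-x).val (by omega)
  refine ⟨i, by omega, ?_⟩
  rw [h]
  simp

/-- The complete graph of odd order decomposes into Hamilton cycles. -/
theorem levelCover_complete {V : Type*} [Fintype V] {h r : ℕ} (hr : 0 < r)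
    (hcard : Fintype.card V = 2 * r + 1) (hh : h ∣ 2 * r + 1) :
    LevelCover h r fun x y : V => x ≠ y := by
  have : NeZero (2 * r) := ⟨by omega⟩
  obtain ⟨e⟩ : Nonempty (Option (ZMod (2 * r)) ≃ V) :=
    ⟨Fintype.equivOfCardEq (by rw [Fintype.card_option, ZMod.card, hcard])⟩
  let z : ℕ → ZMod (2 * r) := fun i => zigzag (2 * r - 1) i
  let c : ℕ → Option (ZMod (2 * r)) := fun i => if i < 2 * r then some (z i) else none
  have hc : ∀ i < 2 * r, c i = some (z i) := fun i hi => if_pos hi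
  have hcn : c (2 * r) = none := if_neg (lt_irrefl _)
  have hz0 : z 0 = 0 := by simp [z, zigzag]
  have hz1 : z (2 * r - 1) = -(r : ZMod (2 * r)) := by
    simp only [z]
    rw [show 2 * r - 1 = 2 * (r - 1) + 1 by omega, zigzag_odd, ← show 2 * r - 1 = 2 * (r - 1) + 1 by omega,
      Nat.cast_sub (by omega), Nat.cast_sub (by omega)]
    push_cast
    ring
  obtain ⟨τ, hτ, hs, hw⟩ := exists_perm_of_cycle (V := Option (ZMod (2 * r))) (by omega) hh
    (by rw [Fintype.card_option, ZMod.card]) c (by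
      rintro (_ | x)
      · exact ⟨2 * r, by omega, hcn⟩
      · obtain ⟨i, hi, hx⟩ := exists_zigzag_cast_eq r hr x
        exact ⟨i, by omega, by rw [hc i hi, ← hx]⟩)
  let ρ : ℕ → Option (ZMod (2 * r)) ≃ V := fun j =>
    (Equiv.optionCongr (Equiv.addRight (j : ZMod (2 * r)))).trans e
  have hρ : ∀ j x, ρ j (some x) = e (some (x + j)) := fun j x => rfl
  have hρn : ∀ j, ρ j none = e none := fun j => rfl
  refine ⟨fun j => (ρ j).permCongr τ, fun j => hτ.permCongr _, fun x y hxy => ?_⟩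
  -- The point `none` closes the zigzag between its ends `0` and `-r`. Its neighbours in the
  -- translates by `j < r` are `j` and `j - r`, which exhaust `ZMod (2 * r)`.
  have hnone : ∀ x : ZMod (2 * r), ∃ j : Fin r,
      Joins ((ρ j).permCongr τ) (e none) (e (some x)) := by
    intro x
    rcases lt_or_ge x.val r with h1 | h1
    · refine ⟨⟨x.val, h1⟩, ?_⟩
      have h2 := (joins_permCongr (ρ x.val) _ _ _).2 hw
      rw [Nat.add_sub_cancel, hcn, hc 0 (by omega), hρ, hρn, hz0] at h2
      simpa using h2
    · have hlt := ZMod.val_lt x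
      refine ⟨⟨x.val - r, by omega⟩, ?_⟩
      have h2 := (joins_permCongr (ρ (x.val - r)) _ _ _).2 (hs (2 * r - 1) (by omega))
      rw [Nat.sub_add_cancel (by omega), hcn, hc _ (by omega), hρ, hρn, hz1,
        Nat.cast_sub h1, ZMod.natCast_zmod_val] at h2
      have h3 : -(r : ZMod (2 * r)) + (x - r) = x := by
        have := ZMod.natCast_self (2 * r)
        push_cast at this
        linear_combination -this
      rw [h3] at h2
      exact h2.symm
  obtain ⟨_ | x, rfl⟩ := e.surjective x <;> obtain ⟨_ | y, rfl⟩ := e.surjective y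
  · exact absurd rfl hxy
  · exact hnone y
  · obtain ⟨j, hj⟩ := hnone x
    exact ⟨j, hj.symm⟩
  · obtain ⟨j, hj, i, hi, h1⟩ := exists_zigzag_step r x y (fun h => hxy (by rw [h])) hr
    have h2 := (joins_permCongr (ρ j) _ _ _).2 (hs i (by omega))
    rw [hc i (by omega), hc _ hi, hρ, hρ] at h2
    refine ⟨⟨j, hj⟩, ?_⟩
    rcases h1 with ⟨rfl, rfl⟩ | ⟨rfl, rfl⟩
    · exact h2
    · exact h2.symm

/-- The vertices `(x, false)` and `(x + d, true)`. -/
def MixedPair {g : ℕ} (d : ZMod g) (x y : ZMod g × Bool) : Prop :=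
  x.2 = false ∧ y.2 = true ∧ y.1 = x.1 + d

/-- Two copies of the complete graph of even order with a matching between them decompose into
Hamilton cycles. -/
theorem levelCover_prism {h r : ℕ} (hr : 0 < r) (hh : h ∣ 2 * r) (d : ZMod (2 * r)) :
    LevelCover h r fun x y : ZMod (2 * r) × Bool => (x.2 = y.2 ∧ x ≠ y) ∨ MixedPair d x y := by
  have : NeZero (2 * r) := ⟨by omega⟩
  let z : ℕ → ZMod (2 * r) := fun i => zigzag (2 * r - 1) i
  -- The zigzag in one copy, then its translate by `d` backwards in the other. The two connecting
  -- edges sit at the ends `0` and `-r`, so `r` translates yield the full matching of difference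
  -- `d`.
  let c : ℕ → ZMod (2 * r) × Bool := fun i =>
    if i < 2 * r then (z i, false) else (z (4 * r - 1 - i) + d, true)
  have hc : ∀ i < 2 * r, c i = (z i, false) := fun i hi => if_pos hi
  have hc' : ∀ i < 2 * r, c (4 * r - 1 - i) = (z i + d, true) := fun i hi => by
    simp only [c]
    rw [if_neg (by omega), show 4 * r - 1 - (4 * r - 1 - i) = i by omega]
  have hz0 : z 0 = 0 := by simp [z, zigzag]
  have hz1 : z (2 * r - 1) = -(r : ZMod (2 * r)) := by
    simp only [z]
    rw [show 2 * r - 1 = 2 * (r - 1) + 1 by omega, zigzag_odd, ← show 2 * r - 1 = 2 * (r - 1) + 1 by omega,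
      Nat.cast_sub (by omega), Nat.cast_sub (by omega)]
    push_cast
    ring
  obtain ⟨τ, hτ, hs, hw⟩ := exists_perm_of_cycle (V := ZMod (2 * r) × Bool) (h := h) (L := 4 * r)
    (by omega) (hh.trans ⟨2, by ring⟩)
    (by rw [Fintype.card_prod, ZMod.card, Fintype.card_bool]; ring) c (by
      rintro ⟨x, _ | _⟩
      · obtain ⟨i, hi, hx⟩ := exists_zigzag_cast_eq r hr x
        exact ⟨i, by omega, by rw [hc i hi, ← hx]⟩
      · obtain ⟨i, hi, hx⟩ := exists_zigzag_cast_eq r hr (x - d)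
        exact ⟨4 * r - 1 - i, by omega, by rw [hc' i hi]; simp only [z]; rw [hx, sub_add_cancel]⟩)
  let ρ : ℕ → ZMod (2 * r) × Bool ≃ ZMod (2 * r) × Bool := fun j =>
    Equiv.prodCongr (Equiv.addRight (j : ZMod (2 * r))) (Equiv.refl _)
  have hρ : ∀ j x b, ρ j (x, b) = (x + j, b) := fun j x b => rfl
  refine ⟨fun j => (ρ j).permCongr τ, fun j => hτ.permCongr _, ?_⟩
  rintro ⟨x, b⟩ ⟨y, b'⟩ (⟨rfl : b = b', hxy⟩ | ⟨rfl : b = false, rfl : b' = true, rfl : y = x + d⟩)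
  · obtain ⟨j, hj, i, hi, h1⟩ := exists_zigzag_step r (x - cond b d 0) (y - cond b d 0)
      (fun h => hxy (by rw [sub_left_injective h])) hr
    refine ⟨⟨j, hj⟩, ?_⟩
    have h2 : Joins ((ρ j).permCongr τ) (z i + j + cond b d 0, b) (z (i + 1) + j + cond b d 0, b) := by
      cases b
      · have h2 := (joins_permCongr (ρ j) _ _ _).2 (hs i (by omega))
        rw [hc i (by omega), hc _ hi, hρ, hρ] at h2
        simpa using h2
      · have h2 := (joins_permCongr (ρ j) _ _ _).2 (hs (4 * r - 1 - (i + 1)) (by omega))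
        rw [show 4 * r - 1 - (i + 1) + 1 = 4 * r - 1 - i by omega, hc' i (by omega), hc' _ hi, hρ,
          hρ, add_right_comm, add_right_comm (z i)] at h2
        exact h2.symm
    rcases h1 with ⟨hx, hy⟩ | ⟨hx, hy⟩
    · rw [sub_eq_iff_eq_add.1 hx, sub_eq_iff_eq_add.1 hy]
      exact h2
    · rw [sub_eq_iff_eq_add.1 hx, sub_eq_iff_eq_add.1 hy]
      exact h2.symm
  · rcases lt_or_ge x.val r with h1 | h1
    · refine ⟨⟨x.val, h1⟩, ?_⟩
      have h2 := (joins_permCongr (ρ x.val) _ _ _).2 hw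
      have h3 := hc' 0 (by omega)
      rw [Nat.sub_zero] at h3
      rw [h3, hc 0 (by omega), hρ, hρ, hz0, zero_add, zero_add, ZMod.natCast_zmod_val,
        add_comm d] at h2
      exact h2.symm
    · have hlt := ZMod.val_lt x
      refine ⟨⟨x.val - r, by omega⟩, ?_⟩
      have h2 := (joins_permCongr (ρ (x.val - r)) _ _ _).2 (hs (2 * r - 1) (by omega))
      have h4 := hc' (2 * r - 1) (by omega)
      rw [show 4 * r - 1 - (2 * r - 1) = 2 * r - 1 + 1 by omega] at h4
      rw [h4, hc _ (by omega), hρ, hρ, hz1, Nat.cast_sub h1, ZMod.natCast_zmod_val,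
        add_right_comm] at h2
      have h3 : -(r : ZMod (2 * r)) + (x - r) = x := by
        have := ZMod.natCast_self (2 * r)
        push_cast at this
        linear_combination -this
      rw [h3] at h2
      exact h2

set_option linter.unnecessarySeqFocus false in
/-- Two consecutive mixed differences form a Hamilton cycle. -/
theorem levelCover_mixed {h g : ℕ} (hh : h ∣ g) (lo : ZMod g) (N : ℕ) :
    LevelCover h N fun x y : ZMod g × Bool => ∃ i : ℕ, i < 2 * N ∧ MixedPair (lo + (i : ZMod g)) x y := by
  -- The cycle runs `(x, false), (x + d, true), (x - 1, false), …`, using the differences `d` and `d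
  -- + 1` in turn.
  let τ : ZMod g → Perm (ZMod g × Bool) := fun d =>
    { toFun := fun x => cond x.2 (x.1 - d - 1, false) (x.1 + d, true)
      invFun := fun x => cond x.2 (x.1 - d, false) (x.1 + d + 1, true)
      left_inv := by rintro ⟨x, _ | _⟩ <;> simp <;> ring
      right_inv := by rintro ⟨x, _ | _⟩ <;> simp <;> ring }
  refine ⟨fun j => τ (lo + (2 * j : ℕ)), fun j => ?_, ?_⟩
  · let φ := ZMod.castHom hh (ZMod h)
    -- Two steps lower the first coordinate by one, so minus twice that coordinate serves as the
    -- level on the copy `false`.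
    refine ⟨fun x => cond x.2 (1 - 2 * φ (x.1 - (lo + (2 * j : ℕ)))) (-2 * φ x.1), ?_⟩
    rintro ⟨x, _ | _⟩
    · simp only [τ, Equiv.coe_fn_mk, cond_true, cond_false, add_sub_cancel_right]
      ring
    · simp only [τ, Equiv.coe_fn_mk, cond_true, cond_false]
      rw [map_sub φ _ 1, map_one]
      ring
  · rintro ⟨x, b⟩ ⟨y, b'⟩ ⟨i, hi, rfl : b = false, rfl : b' = true, rfl : y = x + (lo + (i : ZMod g))⟩
    refine ⟨⟨i / 2, by omega⟩, ?_⟩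
    rcases Nat.mod_two_eq_zero_or_one i with h2 | h2
    · left
      simp only [τ, Equiv.coe_fn_mk, cond_false]
      rw [show 2 * (i / 2) = i by omega]
    · right
      simp only [τ, Equiv.coe_fn_mk, cond_true]
      rw [Prod.mk.injEq]
      refine ⟨?_, rfl⟩
      have : (i : ZMod g) = (2 * (i / 2) : ℕ) + 1 := by
        rw [← Nat.cast_succ]
        congr 1
        omega
      rw [this]
      ring

/-! ### The base Hamilton cycle -/

/-- The symmetric relation `Q` holds along the closed list `c 0, …, c (N - 1)`, except perhaps for
the steps to `c j` with `P j`. -/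
structure RunsAlong {V : Type*} (Q : V → V → Prop) (c : ℕ → V) (N : ℕ) (P : ℕ → Prop) :
    Prop where
  symm : ∀ x y, Q x y → Q y x
  step : ∀ j, j + 1 < N → ¬ P (j + 1) → Q (c j) (c (j + 1))
  wrap : Q (c (N - 1)) (c 0)

/-- For even `g` two cycles are used that differ only in the place of one inserted vertex. A step
untouched by both insertions is found at the same place in either, whichever of them a translation
uses. -/
theorem RunsAlong.forall {V ι : Type*} {Q : ι → V → V → Prop} {c : ℕ → V} {N : ℕ}
    {P : ι → ℕ → Prop} (hQ : ∀ b, RunsAlong (Q b) c N (P b)) :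
    RunsAlong (fun x y => ∀ b, Q b x y) c N fun j => ∃ b, P b j where
  symm x y h b := (hQ b).symm x y (h b)
  step j hj hP b := (hQ b).step j hj fun h => hP ⟨b, h⟩
  wrap b := (hQ b).wrap

/-- Insertion of `x` before `c p` into a closed list `c` of the other vertices. -/
theorem exists_runsAlong {V : Type*} [Fintype V] {h N p : ℕ} (hp : 0 < p) (hpN : p < N)
    (hh : h ∣ N + 1) (hcard : Fintype.card V = N + 1) (c : ℕ → V) (x : V)
    (hc : ∀ v, v ≠ x → ∃ j < N, c j = v) :
    ∃ τ : Perm V, HasLevel h τ ∧ RunsAlong (Joins τ) c N (· = p) ∧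
      Joins τ x (c (p - 1)) ∧ Joins τ x (c p) := by
  let c' : ℕ → V := fun j => if j < p then c j else if j = p then x else c (j - 1)
  have h1 : ∀ j < p, c' j = c j := fun j hj => if_pos hj
  have h2 : c' p = x := by simp [c']
  have h3 : ∀ j, p ≤ j → c' (j + 1) = c j := fun j hj => by
    simp only [c']
    rw [if_neg (by omega), if_neg (by omega), Nat.add_sub_cancel]
  obtain ⟨τ, hτ, hs, hw⟩ := exists_perm_of_cycle (by omega) hh hcard c' (by
    intro v
    by_cases hv : v = x
    · exact ⟨p, by omega, by rw [h2, hv]⟩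
    · obtain ⟨j, hj, rfl⟩ := hc v hv
      rcases lt_or_ge j p with hjp | hjp
      · exact ⟨j, by omega, h1 j hjp⟩
      · exact ⟨j + 1, by omega, h3 j hjp⟩)
  refine ⟨τ, hτ, ⟨fun _ _ => Joins.symm, fun j hj hjp => ?_, ?_⟩, ?_, ?_⟩
  · rcases lt_or_ge (j + 1) p with hlt | hge
    · have := hs j (by omega)
      rwa [h1 j (by omega), h1 _ hlt] at this
    · have := hs (j + 1) (by omega)
      rwa [h3 j (by omega), h3 _ hge] at this
  · have := h3 (N - 1) (by omega)
    rw [Nat.sub_add_cancel (by omega)] at this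
    rwa [Nat.add_sub_cancel, this, h1 0 hp] at hw
  · have := hs (p - 1) (by omega)
    rw [Nat.sub_add_cancel hp, h2, h1 _ (by omega)] at this
    exact this.symm
  · have := hs p (by omega)
    rwa [h2, h3 p le_rfl] at this

/-- A closed list of the vertices other than the last one of `Fin n`: a mixed zigzag on `2 * t`
vertices, a zigzag in each of the two copies of `ZMod g`, and the remaining vertices of the two
copies in turn, separated by vertices of `Fin n`. -/
def coreList (n g a t : ℕ) [NeZero n] (j : ℕ) : Fin n ⊕ ZMod g × Bool :=
  if j < 2 * t then
    if j % 2 = 0 then Sum.inr ((t : ZMod g) - (j / 2 : ℕ), false)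
    else Sum.inr ((j / 2 : ℕ) + 1, true)
  else if j < 2 * t + a + 1 then Sum.inr (zigzag a (j - 2 * t), false)
  else if j = 2 * t + a + 1 then Sum.inl (Fin.ofNat n 0)
  else if j < 2 * t + 2 * a + 3 then Sum.inr (zigzag a (j - (2 * t + a + 2)), true)
  else if (j - (2 * t + 2 * a + 3)) % 2 = 0 then
    Sum.inl (Fin.ofNat n ((j - (2 * t + 2 * a + 3)) / 2 + 1))
  else Sum.inr (t + 1 + ((j - (2 * t + 2 * a + 3)) / 4 : ℕ),
    decide ((j - (2 * t + 2 * a + 3)) % 4 = 3))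

section
variable {n g a t : ℕ} [NeZero n]

theorem coreList_even {i : ℕ} (hi : i < t) :
    coreList n g a t (2 * i) = Sum.inr ((t : ZMod g) - i, false) := by
  rw [coreList, if_pos (by omega), if_pos (by omega), show 2 * i / 2 = i by omega]

theorem coreList_odd {i : ℕ} (hi : i < t) :
    coreList n g a t (2 * i + 1) = Sum.inr ((i : ZMod g) + 1, true) := by
  rw [coreList, if_pos (by omega), if_neg (by omega), show (2 * i + 1) / 2 = i by omega]

theorem coreList_zigzag_false {i : ℕ} (hi : i ≤ a) :
    coreList n g a t (2 * t + i) = Sum.inr ((zigzag a i : ZMod g), false) := by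
  rw [coreList, if_neg (by omega), if_pos (by omega), show 2 * t + i - 2 * t = i by omega]

theorem coreList_gap_zero : coreList n g a t (2 * t + a + 1) = Sum.inl (Fin.ofNat n 0) := by
  rw [coreList, if_neg (by omega), if_neg (by omega), if_pos rfl]

theorem coreList_zigzag_true {i : ℕ} (hi : i ≤ a) :
    coreList n g a t (2 * t + a + 2 + i) = Sum.inr ((zigzag a i : ZMod g), true) := by
  rw [coreList, if_neg (by omega), if_neg (by omega), if_neg (by omega), if_pos (by omega),
    show 2 * t + a + 2 + i - (2 * t + a + 2) = i by omega]

theorem coreList_gap_succ (r : ℕ) :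
    coreList n g a t (2 * t + 2 * a + 3 + 2 * r) = Sum.inl (Fin.ofNat n (r + 1)) := by
  rw [coreList, if_neg (by omega), if_neg (by omega), if_neg (by omega), if_neg (by omega),
    if_pos (by omega), show (2 * t + 2 * a + 3 + 2 * r - (2 * t + 2 * a + 3)) / 2 = r by omega]

theorem coreList_rest_false (u : ℕ) :
    coreList n g a t (2 * t + 2 * a + 4 + 4 * u) = Sum.inr ((t : ZMod g) + 1 + u, false) := by
  rw [coreList, if_neg (by omega), if_neg (by omega), if_neg (by omega), if_neg (by omega),
    if_neg (by omega), show (2 * t + 2 * a + 4 + 4 * u - (2 * t + 2 * a + 3)) / 4 = u by omega,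
    decide_eq_false (by omega)]

theorem coreList_rest_true (u : ℕ) :
    coreList n g a t (2 * t + 2 * a + 6 + 4 * u) = Sum.inr ((t : ZMod g) + 1 + u, true) := by
  rw [coreList, if_neg (by omega), if_neg (by omega), if_neg (by omega), if_neg (by omega),
    if_neg (by omega), show (2 * t + 2 * a + 6 + 4 * u - (2 * t + 2 * a + 3)) / 4 = u by omega,
    decide_eq_true (by omega)]

theorem coreList_zigzag (b : Bool) {i : ℕ} (hi : i ≤ a) :
    coreList n g a t (2 * t + cond b (a + 2) 0 + i) = Sum.inr ((zigzag a i : ZMod g), b) := by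
  cases b
  · rw [cond_false, add_zero, coreList_zigzag_false hi]
  · rw [cond_true, ← add_assoc, coreList_zigzag_true hi]

theorem coreList_zigzag_start (b : Bool) :
    coreList n g a t (2 * t + cond b (a + 2) 0) = Sum.inr (0, b) := by
  have := coreList_zigzag (n := n) (g := g) (t := t) b (Nat.zero_le a)
  rw [add_zero] at this
  simpa [zigzag] using this

theorem coreList_zigzag_next (ha : 1 ≤ a) (b : Bool) :
    coreList n g a t (2 * t + cond b (a + 2) 0 + 1) = Sum.inr (-(a : ZMod g), b) := by
  rw [coreList_zigzag b ha]
  simp [zigzag]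

theorem coreList_before_zigzag (ht : 1 ≤ t) :
    coreList n g a t (2 * t - 1) = Sum.inr ((t : ZMod g), true) := by
  rw [show 2 * t - 1 = 2 * (t - 1) + 1 by omega, coreList_odd (by omega), Nat.cast_sub ht]
  simp

variable (hn : n + 2 * a + 2 * t = 2 * g + 1) (hn3 : 3 ≤ n)
include hn hn3

/-- In each copy the mixed zigzag takes the residues `1, …, t`, the pure one `0, -1, …, -a`, and `g
- t - a - 1` remain. By `hn` these are `n - 3` vertices in all, separated and bounded by the `n - 2`
elements `1, …, n - 2` of `Fin n`; the element `0` separates the two pure zigzags. -/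
theorem exists_coreList_eq (v : Fin n ⊕ ZMod g × Bool) (hv : v ≠ Sum.inl (Fin.ofNat n (n - 1))) :
    ∃ j < 2 * g + n - 1, coreList n g a t j = v := by
  have : NeZero g := ⟨by omega⟩
  rcases v with r | ⟨s, b⟩
  · have hr := r.2
    have hne : r.val ≠ n - 1 := fun h => hv (by
      congr 1
      apply Fin.ext
      rw [Fin.val_ofNat, Nat.mod_eq_of_lt (by omega), h])
    have hrr : ∀ k, k = r.val → Fin.ofNat n k = r := fun k hk => by
      subst hk
      apply Fin.ext
      rw [Fin.val_ofNat, Nat.mod_eq_of_lt hr]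
    rcases Nat.eq_zero_or_pos r.val with h0 | h0
    · exact ⟨2 * t + a + 1, by omega, by rw [coreList_gap_zero, hrr _ h0.symm]⟩
    · exact ⟨2 * t + 2 * a + 3 + 2 * (r.val - 1), by omega, by rw [coreList_gap_succ, hrr _ (by omega)]⟩
  · have hlt := ZMod.val_lt s
    by_cases h1 : (-s).val ≤ a
    · obtain ⟨i, hi, h2⟩ := exists_zigzag_eq a _ h1
      have h3 : (zigzag a i : ZMod g) = s := by rw [h2]; simp
      cases b
      · exact ⟨2 * t + i, by omega, by rw [coreList_zigzag_false hi, h3]⟩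
      · exact ⟨2 * t + a + 2 + i, by omega, by rw [coreList_zigzag_true hi, h3]⟩
    · have hs0 : s ≠ 0 := by rintro rfl; simp at h1
      have hpos : 0 < s.val := Nat.pos_of_ne_zero fun h => hs0 ((ZMod.val_eq_zero s).1 h)
      rw [ZMod.neg_val, if_neg hs0] at h1
      rcases le_or_gt s.val t with h2 | h2
      · cases b
        · refine ⟨_, ?_, (coreList_even (i := t - s.val) (by omega)).trans ?_⟩
          · omega
          · rw [Nat.cast_sub h2, ZMod.natCast_zmod_val, sub_sub_cancel]
        · refine ⟨_, ?_, (coreList_odd (i := s.val - 1) (by omega)).trans ?_⟩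
          · omega
          · rw [Nat.cast_sub hpos, ZMod.natCast_zmod_val]; simp
      · have h3 : (t : ZMod g) + 1 + (s.val - t - 1 : ℕ) = s := by
          rw [Nat.cast_sub (by omega), Nat.cast_sub (by omega), ZMod.natCast_zmod_val]
          push_cast
          ring
        cases b
        · exact ⟨_, by omega, (coreList_rest_false (s.val - t - 1)).trans (by rw [h3])⟩
        · exact ⟨_, by omega, (coreList_rest_true (s.val - t - 1)).trans (by rw [h3])⟩

variable {Q : Fin n ⊕ ZMod g × Bool → Fin n ⊕ ZMod g × Bool → Prop} {P : ℕ → Prop} (ht : 1 ≤ t)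
  (hQ : RunsAlong Q (coreList n g a t) (2 * g + n - 1) P)
include ht hQ

-- The mixed zigzag realizes the differences `1 - t, …, t - 1` in increasing order; the step from it
-- to the first pure zigzag adds the difference `t`.
omit ht in
theorem RunsAlong.mixed (hp : ∀ j, P j → 2 * t ≤ j) (d : ℤ) (h1 : -(t : ℤ) < d) (h2 : d < t) :
    ∃ s : ZMod g, Q (Sum.inr (s, false)) (Sum.inr (s + d, true)) := by
  obtain ⟨e, rfl⟩ : ∃ e : ℕ, d = e + 1 - t := ⟨(d + t - 1).toNat, by omega⟩
  obtain ⟨i, rfl | rfl⟩ := Nat.even_or_odd' e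
  · have := hQ.step (2 * i) (by omega)
            fun h => by have := hp _ h; omega
    rw [coreList_even (by omega), coreList_odd (by omega)] at this
    refine ⟨t - i, ?_⟩
    convert this using 3
    push_cast
    ring
  · have := hQ.step (2 * i + 1) (by omega)
            fun h => by have := hp _ h; omega
    rw [coreList_odd (by omega), show 2 * i + 1 + 1 = 2 * (i + 1) by ring,
      coreList_even (by omega)] at this
    refine ⟨t - (i + 1 : ℕ), ?_⟩
    convert (hQ.symm _ _ this) using 3
    push_cast
    ring

theorem RunsAlong.mixed_last (hp : ∀ j, P j → 2 * t < j) :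
    ∃ s : ZMod g, Q (Sum.inr (s, false)) (Sum.inr (s + (t : ℤ), true)) := by
  have := hQ.step (2 * (t - 1) + 1) (by omega)
            fun h => by have := hp _ h; omega
  rw [coreList_odd (by omega), show 2 * (t - 1) + 1 + 1 = 2 * t + 0 by omega,
    coreList_zigzag_false (by omega)] at this
  refine ⟨zigzag a 0, ?_⟩
  convert (hQ.symm _ _ this) using 3
  rw [Nat.cast_sub ht]
  simp [zigzag]

-- The steps of a pure zigzag have lengths `a, a - 1, …, 1`, so the length `d` occurs at the index
-- `a - d`.
omit ht in
theorem RunsAlong.pure (b : Bool) (d : ℕ) (h1 : 1 ≤ d) (h2 : d ≤ a)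
    (hp : ¬ P (2 * t + cond b (a + 2) 0 + (a - d) + 1)) :
    ∃ s : ZMod g, Q (Sum.inr (s, b)) (Sum.inr (s + d, b)) := by
  have key : Q (Sum.inr (zigzag a (a - d), b)) (Sum.inr (zigzag a (a - d + 1), b)) := by
    have := hQ.step (2 * t + cond b (a + 2) 0 + (a - d)) (by cases b <;> simp <;> omega) hp
    rwa [add_assoc _ (a - d), coreList_zigzag b (by omega), coreList_zigzag b (by omega)] at this
  rcases zigzag_sub a (a - d) with h | h
  · refine ⟨zigzag a (a - d), ?_⟩
    convert key using 3
    rw [Nat.cast_sub h2, sub_sub_cancel] at h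
    have := congrArg (Int.cast (R := ZMod g)) h
    push_cast at this
    linear_combination -this
  · refine ⟨zigzag a (a - d + 1), ?_⟩
    convert (hQ.symm _ _ key) using 3
    rw [Nat.cast_sub h2, sub_sub_cancel] at h
    have := congrArg (Int.cast (R := ZMod g)) h
    push_cast at this
    linear_combination this

/-- Each listed element of `Fin n` stands between a vertex of the copy `false` and one of the copy
`true`, so its translates meet both copies completely. -/
theorem RunsAlong.cross (hp : ∀ j, P j → j = 2 * t ∨ 1 ≤ a ∧ (j = 2 * t + 1 ∨ j = 2 * t + a + 3))
    (r : ℕ) (hr : r + 1 < n) (b : Bool) :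
    ∃ s : ZMod g, Q (Sum.inl (Fin.ofNat n r)) (Sum.inr (s, b)) := by
  rcases r with _ | r
  · cases b
    · have := hQ.step (2 * t + a) (by omega)
            fun h => by have := hp _ h; omega
      rw [coreList_gap_zero, coreList_zigzag_false le_rfl] at this
      exact ⟨_, (hQ.symm _ _ this)⟩
    · have := hQ.step (2 * t + a + 1) (by omega)
            fun h => by have := hp _ h; omega
      rw [coreList_gap_zero, show 2 * t + a + 1 + 1 = 2 * t + a + 2 + 0 by ring,
        coreList_zigzag_true (by omega)] at this
      exact ⟨_, this⟩
  · rw [← coreList_gap_succ (g := g) (a := a) (t := t)]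
    obtain ⟨u, rfl | rfl⟩ := Nat.even_or_odd' r
    · cases b
      · rcases eq_or_lt_of_le (show 2 * u + 3 ≤ n by omega) with hu | hu
        -- The element `n - 2` ends the list, and its neighbour in the copy `false` is the start of
        -- the list.
        · have := hQ.wrap
          rw [show 2 * g + n - 1 - 1 = 2 * t + 2 * a + 3 + 2 * (2 * u) by omega,
            show (0 : ℕ) = 2 * 0 by rfl, coreList_even (i := 0) (by omega)] at this
          exact ⟨_, this⟩
        · have := hQ.step (2 * t + 2 * a + 3 + 2 * (2 * u)) (by omega)
            fun h => by have := hp _ h; omega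
          rw [show 2 * t + 2 * a + 3 + 2 * (2 * u) + 1 = 2 * t + 2 * a + 4 + 4 * u by ring,
            coreList_rest_false] at this
          exact ⟨_, this⟩
      · rcases u with _ | u
        · have := hQ.step (2 * t + a + 2 + a) (by omega)
            fun h => by have := hp _ h; omega
          rw [coreList_zigzag_true le_rfl,
            show 2 * t + a + 2 + a + 1 = 2 * t + 2 * a + 3 + 2 * (2 * 0) by ring] at this
          exact ⟨_, (hQ.symm _ _ this)⟩
        · have := hQ.step (2 * t + 2 * a + 6 + 4 * u) (by omega)
            fun h => by have := hp _ h; omega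
          rw [coreList_rest_true, show 2 * t + 2 * a + 6 + 4 * u + 1 =
            2 * t + 2 * a + 3 + 2 * (2 * (u + 1)) by ring] at this
          exact ⟨_, (hQ.symm _ _ this)⟩
    · cases b
      · have := hQ.step (2 * t + 2 * a + 4 + 4 * u) (by omega)
            fun h => by have := hp _ h; omega
        rw [coreList_rest_false, show 2 * t + 2 * a + 4 + 4 * u + 1 =
          2 * t + 2 * a + 3 + 2 * (2 * u + 1) by ring] at this
        exact ⟨_, (hQ.symm _ _ this)⟩
      · have := hQ.step (2 * t + 2 * a + 3 + 2 * (2 * u + 1)) (by omega)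
            fun h => by have := hp _ h; omega
        rw [show 2 * t + 2 * a + 3 + 2 * (2 * u + 1) + 1 = 2 * t + 2 * a + 6 + 4 * u by ring,
          coreList_rest_true] at this
        exact ⟨_, this⟩

-- The endpoints are given explicitly because for `g = 2 * a` the difference `a` is its own
-- negative, and it matters which translates carry it.
omit ht in
theorem RunsAlong.pure_last (ha : 1 ≤ a) (b : Bool)
    (hp : ¬ P (2 * t + cond b (a + 2) 0 + 1)) : Q (Sum.inr (0, b)) (Sum.inr (-(a : ZMod g), b)) := by
  have := hQ.step (2 * t + cond b (a + 2) 0) (by cases b <;> simp <;> omega) hp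
  rwa [coreList_zigzag_start, coreList_zigzag_next ha] at this

end

/-! ### Translating the base cycle -/

/-- The translation of both copies of `ZMod g` by `i`. -/
def shiftBy (n : ℕ) {g : ℕ} (i : ZMod g) : Fin n ⊕ ZMod g × Bool ≃ Fin n ⊕ ZMod g × Bool :=
  Equiv.sumCongr (Equiv.refl _) (Equiv.prodCongr (Equiv.addRight i) (Equiv.refl _))

theorem Joins.shiftBy_inr {n g : ℕ} {τ : Perm (Fin n ⊕ ZMod g × Bool)} {s s' : ZMod g}
    {b b' : Bool} (h : Joins τ (Sum.inr (s, b)) (Sum.inr (s', b'))) (i : ZMod g) :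
    Joins ((shiftBy n i).permCongr τ) (Sum.inr (s + i, b)) (Sum.inr (s' + i, b')) :=
  (joins_permCongr (shiftBy n i) τ _ _).2 h

theorem Joins.shiftBy_inl {n g : ℕ} {τ : Perm (Fin n ⊕ ZMod g × Bool)} {s : ZMod g}
    {r : Fin n} {b : Bool} (h : Joins τ (Sum.inl r) (Sum.inr (s, b))) (i : ZMod g) :
    Joins ((shiftBy n i).permCongr τ) (Sum.inl r) (Sum.inr (s + i, b)) :=
  (joins_permCongr (shiftBy n i) τ _ _).2 h

/-- `g` Hamilton cycles, and `(n - 1) / 2` further 2-factors on `ZMod g × Bool`, with cycle lengths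
divisible by `h`, that together cover all pairs not inside `Fin n`. -/
def HasBaseCover (h n g : ℕ) : Prop :=
  ∃ F : ZMod g → Perm (Fin n ⊕ ZMod g × Bool), (∀ i, HasLevel h (F i)) ∧
    (∀ x y, ∃ i, Joins (F i) (Sum.inl x) (Sum.inr y)) ∧
    ∃ R : ZMod g × Bool → ZMod g × Bool → Prop, LevelCover h ((n - 1) / 2) R ∧
      ∀ x y, x ≠ y → (∃ i, Joins (F i) (Sum.inr x) (Sum.inr y)) ∨ R x y ∨ R y x

/-- The window from `lo` of width `w` holds the mixed differences left to the 2-factors; the others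
get integer representatives just below `lo`, the range reached by the mixed zigzag. -/
theorem exists_natCast_or_intCast_add {g : ℕ} [NeZero g] (lo w : ℕ) (s s' : ZMod g) :
    (∃ i : ℕ, i < w ∧ s' = s + ((lo : ZMod g) + (i : ZMod g))) ∨
      ∃ d : ℤ, (lo : ℤ) + w - g ≤ d ∧ d < lo ∧ s' = s + d := by
  have hlt := ZMod.val_lt (s' - s - (lo : ZMod g))
  rcases lt_or_ge (s' - s - (lo : ZMod g)).val w with h | h
  · exact Or.inl ⟨(s' - s - (lo : ZMod g)).val, h, by rw [ZMod.natCast_zmod_val]; ring⟩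
  · refine Or.inr ⟨lo + (s' - s - (lo : ZMod g)).val - g, by omega, by omega, ?_⟩
    push_cast
    rw [ZMod.natCast_zmod_val, ZMod.natCast_self]
    ring

theorem exists_natCast_add_of_ne {g a : ℕ} [NeZero g] (ha : g ≤ 2 * a + 1) {s s' : ZMod g}
    (h : s ≠ s') : ∃ d : ℕ, 1 ≤ d ∧ d ≤ a ∧ (s' = s + d ∨ s = s' + d) := by
  have hlt := ZMod.val_lt (s' - s)
  have h0 : (s' - s).val ≠ 0 := fun h0 => h (sub_eq_zero.1 ((ZMod.val_eq_zero _).1 h0)).symm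
  rcases le_or_gt (s' - s).val a with h1 | h1
  · exact ⟨_, by omega, h1, Or.inl (by rw [ZMod.natCast_zmod_val]; ring)⟩
  · refine ⟨g - (s' - s).val, by omega, by omega, Or.inr ?_⟩
    rw [Nat.cast_sub hlt.le, ZMod.natCast_zmod_val, ZMod.natCast_self]
    ring

section
variable {h n g a t : ℕ} [NeZero n] [NeZero g]

theorem exists_runsAlong_coreList (hn : n + 2 * a + 2 * t = 2 * g + 1) (hn3 : 3 ≤ n) (ht : 1 ≤ t)
    (hh : h ∣ 2 * g + n) {p : ℕ} (hp : 2 * t ≤ p) (hp' : p ≤ 2 * t + a + 3) :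
    ∃ τ : Perm (Fin n ⊕ ZMod g × Bool), HasLevel h τ ∧
      RunsAlong (Joins τ) (coreList n g a t) (2 * g + n - 1) (· = p) ∧
      Joins τ (Sum.inl (Fin.ofNat n (n - 1))) (coreList n g a t (p - 1)) ∧
      Joins τ (Sum.inl (Fin.ofNat n (n - 1))) (coreList n g a t p) :=
  exists_runsAlong (by omega) (by omega) (by rwa [Nat.sub_add_cancel (by omega)])
    (by simp only [Fintype.card_sum, Fintype.card_fin, Fintype.card_prod, ZMod.card,
          Fintype.card_bool]; omega) _ _ (exists_coreList_eq hn hn3)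

/-- All `g` Hamilton cycles are translates of one. -/
theorem hasBaseCover_of_translates (hn : n + 2 * a + 2 * t = 2 * g + 1) (hn3 : 3 ≤ n) (ht : 1 ≤ t)
    (hh : h ∣ 2 * g + n) (R : ZMod g × Bool → ZMod g × Bool → Prop)
    (hR : LevelCover h ((n - 1) / 2) R)
    (hpure : ∀ (b : Bool) (s s' : ZMod g), s ≠ s' →
      (∃ d : ℕ, 1 ≤ d ∧ d ≤ a ∧ (s' = s + d ∨ s = s' + d)) ∨ R (s, b) (s', b))
    (hmixed : ∀ s s' : ZMod g, (∃ d : ℤ, -(t : ℤ) < d ∧ d < t ∧ s' = s + d) ∨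
      R (s, false) (s', true)) : HasBaseCover h n g := by
  -- Position `2 * t` puts the last vertex between `(t, true)` and `(0, false)`: it gets a neighbour
  -- in each copy, at the price of the mixed difference `t`.
  obtain ⟨τ, hl, hτ, hx, hx'⟩ :=
    exists_runsAlong_coreList (a := a) hn hn3 ht hh le_rfl (by omega)
  rw [coreList_before_zigzag ht] at hx
  have h0 := coreList_zigzag_start (n := n) (g := g) (a := a) (t := t) false
  rw [cond_false, add_zero] at h0
  rw [h0] at hx'
  refine ⟨fun i => (shiftBy n i).permCongr τ, fun i => hl.permCongr _, ?_, R, hR, ?_⟩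
  · rintro r ⟨s, b⟩
    obtain ⟨s₀, h0⟩ : ∃ s₀ : ZMod g, Joins τ (Sum.inl r) (Sum.inr (s₀, b)) := by
      have hr := r.2
      have hrr : Fin.ofNat n r.val = r := Fin.ext (by rw [Fin.val_ofNat, Nat.mod_eq_of_lt hr])
      rw [← hrr]
      rcases eq_or_lt_of_le (show r.val + 1 ≤ n by omega) with h1 | h1
      · rw [show r.val = n - 1 by omega]
        cases b
        · exact ⟨_, hx'⟩
        · exact ⟨_, hx⟩
      · exact hτ.cross hn hn3 ht (fun j hj => Or.inl hj) _ h1 b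
    refine ⟨s - s₀, ?_⟩
    have := h0.shiftBy_inl (s - s₀)
    rwa [add_sub_cancel] at this
  · have hp : ∀ (b : Bool) (s : ZMod g) (d : ℕ), 1 ≤ d → d ≤ a →
        ∃ i, Joins ((shiftBy n i).permCongr τ) (Sum.inr (s, b)) (Sum.inr (s + d, b)) := by
      intro b s d h1 h2
      obtain ⟨s₀, h0⟩ := hτ.pure hn hn3 b d h1 h2 (by omega)
      refine ⟨s - s₀, ?_⟩
      have := h0.shiftBy_inr (s - s₀)
      rwa [add_sub_cancel, add_right_comm, add_sub_cancel] at this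
    have hm : ∀ s s' : ZMod g, (∃ i, Joins ((shiftBy n i).permCongr τ) (Sum.inr (s, false))
        (Sum.inr (s', true))) ∨ R (s, false) (s', true) := by
      intro s s'
      rcases hmixed s s' with ⟨d, h1, h2, rfl⟩ | h1
      · left
        obtain ⟨s₀, h0⟩ := hτ.mixed hn hn3 (fun j hj => hj.ge) d h1 h2
        refine ⟨s - s₀, ?_⟩
        have := h0.shiftBy_inr (s - s₀)
        rwa [add_sub_cancel, add_right_comm, add_sub_cancel] at this
      · exact Or.inr h1
    have hpp : ∀ (b : Bool) (s s' : ZMod g), s ≠ s' → (∃ i, Joins ((shiftBy n i).permCongr τ)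
        (Sum.inr (s, b)) (Sum.inr (s', b))) ∨ R (s, b) (s', b) := by
      intro b s s' hne
      rcases hpure b s s' hne with ⟨d, h1, h2, rfl | rfl⟩ | h1
      · exact Or.inl (hp b s d h1 h2)
      · exact Or.inl ((hp b s' d h1 h2).imp fun _ h => h.symm)
      · exact Or.inr h1
    rintro ⟨s, _ | _⟩ ⟨s', _ | _⟩ hne
    · exact (hpp false s s' fun h => hne (by rw [h])).imp_right Or.inl
    · exact (hm s s').imp_right Or.inl
    · exact (hm s' s).imp (fun ⟨i, h⟩ => ⟨i, h.symm⟩) Or.inr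
    · exact (hpp true s s' fun h => hne (by rw [h])).imp_right Or.inl

/-- The Hamilton cycles are translates of two, each of which is used for half of the
translations. -/
theorem hasBaseCover_of_two_translates (hg : g = 2 * a) (hn : n + 2 * t = g + 1) (hn3 : 3 ≤ n)
    (ht : 1 ≤ t) (hh : h ∣ 2 * g + n) (hhg : h ∣ g) : HasBaseCover h n g := by
  have hn : n + 2 * a + 2 * t = 2 * g + 1 := by omega
  have ha : 1 ≤ a := by omega
  -- All translates of one cycle would cover the edges of difference `a = g / 2` twice. So the last
  -- vertex is inserted into the edge of difference `a` of the copy `b`, with `b` depending on the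
  -- translation.
  have key : ∀ b : Bool, ∃ τ : Perm (Fin n ⊕ ZMod g × Bool), HasLevel h τ ∧
      RunsAlong (Joins τ) (coreList n g a t) (2 * g + n - 1)
        (· = 2 * t + cond b (a + 2) 0 + 1) ∧
      Joins τ (Sum.inl (Fin.ofNat n (n - 1))) (Sum.inr (0, b)) ∧
      Joins τ (Sum.inl (Fin.ofNat n (n - 1))) (Sum.inr (-(a : ZMod g), b)) := by
    intro b
    have := exists_runsAlong_coreList (p := 2 * t + cond b (a + 2) 0 + 1) hn hn3 ht hh (by omega)
      (by cases b <;> simp <;> omega)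
    rwa [coreList_zigzag_next ha, Nat.add_sub_cancel, coreList_zigzag_start] at this
  choose τ hl hτ hx hx' using key
  have hQ := RunsAlong.forall hτ
  -- Exactly one of `i` and `i - a` lies in each half. As the last vertex is joined to `0` and `-a`
  -- in the copy `b`, half of the translations suffice to join it to the entire copy.
  let β : ZMod g → Bool := fun i => decide (i.val < a)
  have hβ : ∀ (b : Bool) (i : ZMod g), ∃ j, β j = b ∧ (j = i ∨ j = i - a) := by
    intro b i
    have hlt := ZMod.val_lt i
    by_cases hi : β i = b
    · exact ⟨i, hi, Or.inl rfl⟩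
    · refine ⟨i - a, ?_, Or.inr rfl⟩
      have hcast : ((a + a : ℕ) : ZMod g) = 0 := by
        rw [← two_mul, ← hg, ZMod.natCast_self]
      rcases lt_or_ge i.val a with h1 | h1
      · have h2 : (i - a).val = i.val + a := by
          have : i - a = (i.val + a : ℕ) := by
            push_cast at hcast ⊢
            rw [ZMod.natCast_zmod_val]
            linear_combination -hcast
          rw [this, ZMod.val_cast_of_lt (by omega)]
        have h3 : β i = true := by simp [β, h1]
        have h4 : β (i - a) = false := by simp [β, h2]
        rw [h4]
        revert hi
        rw [h3]
        cases b <;> simp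
      · have h2 : (i - a).val = i.val - a := by
          have : i - a = (i.val - a : ℕ) := by
            rw [Nat.cast_sub h1, ZMod.natCast_zmod_val]
          rw [this, ZMod.val_cast_of_lt (by omega)]
        have h3 : β i = false := by simp [β, h1]
        have h4 : β (i - a) = true := by simp [β, h2]; omega
        rw [h4]
        revert hi
        rw [h3]
        cases b <;> simp
  have hP : ∀ j, (∃ b, j = 2 * t + cond b (a + 2) 0 + 1) → j = 2 * t + 1 ∨ j = 2 * t + a + 3 := by
    rintro j ⟨_ | _, rfl⟩ <;> simp
    omega
  have haa : (-a : ZMod g) = a := by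
    have hcast : ((a + a : ℕ) : ZMod g) = 0 := by
      rw [← two_mul, ← hg, ZMod.natCast_self]
    push_cast at hcast
    linear_combination -hcast
  let F : ZMod g → Perm (Fin n ⊕ ZMod g × Bool) := fun i => (shiftBy n i).permCongr (τ (β i))
  -- The Hamilton cycles use the mixed differences `1 - t, …, t`, leaving `g - 2 * t = n - 1`
  -- consecutive ones from `t + 1`, an even number.
  refine ⟨F, fun i => (hl _).permCongr _, ?_, _, levelCover_mixed hhg ((t + 1 : ℕ) : ZMod g) _, ?_⟩
  · rintro r ⟨s, b⟩
    have hr := r.2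
    have hrr : Fin.ofNat n r.val = r := Fin.ext (by rw [Fin.val_ofNat, Nat.mod_eq_of_lt hr])
    rw [← hrr]
    rcases eq_or_lt_of_le (show r.val + 1 ≤ n by omega) with h1 | h1
    · rw [show r.val = n - 1 by omega]
      obtain ⟨j, hj, hji⟩ := hβ b s
      refine ⟨j, ?_⟩
      simp only [F, hj]
      rcases hji with rfl | rfl
      · have := (hx b).shiftBy_inl j
        rwa [zero_add] at this
      · have := (hx' b).shiftBy_inl (s - a)
        rwa [haa, add_sub_cancel] at this
    · obtain ⟨s₀, h0⟩ := hQ.cross hn hn3 ht (fun j hj => Or.inr ⟨ha, hP j hj⟩) _ h1 b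
      refine ⟨s - s₀, ?_⟩
      have := (h0 (β (s - s₀))).shiftBy_inl (s - s₀)
      rwa [add_sub_cancel] at this
  · have hp : ∀ (b : Bool) (s : ZMod g) (d : ℕ), 1 ≤ d → d ≤ a →
        ∃ i, Joins (F i) (Sum.inr (s, b)) (Sum.inr (s + d, b)) := by
      intro b s d h1 h2
      rcases eq_or_lt_of_le h2 with rfl | h2
      -- Difference `a` in the copy `b` survives only in the cycle of `!b`. Its half of the
      -- translations is enough, since each such edge arises from both `s` and `s - a`.
      · have h0 := (hτ (!b)).pure_last hn hn3 ha b (by cases b <;> simp)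
        rw [haa] at h0
        obtain ⟨j, hj, rfl | rfl⟩ := hβ (!b) s
        · refine ⟨j, ?_⟩
          simp only [F, hj]
          have := h0.shiftBy_inr j
          rwa [zero_add, add_comm] at this
        · refine ⟨s - d, ?_⟩
          simp only [F, hj]
          have := h0.symm.shiftBy_inr (s - d)
          rw [add_sub_cancel, zero_add, sub_eq_add_neg, haa] at this
          rwa [sub_eq_add_neg, haa]
      · obtain ⟨s₀, h0⟩ := hQ.pure hn hn3 b d h1 h2.le (by
          rintro ⟨b', hb'⟩
          cases b <;> cases b' <;> simp at hb' <;> omega)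
        refine ⟨s - s₀, ?_⟩
        have := (h0 (β (s - s₀))).shiftBy_inr (s - s₀)
        rwa [add_sub_cancel, add_right_comm, add_sub_cancel] at this
    have hm : ∀ (s : ZMod g) (d : ℤ), -(t : ℤ) < d → d ≤ t →
        ∃ i, Joins (F i) (Sum.inr (s, false)) (Sum.inr (s + d, true)) := by
      intro s d h1 h2
      obtain ⟨s₀, h0⟩ : ∃ s₀ : ZMod g, ∀ b, Joins (τ b) (Sum.inr (s₀, false))
          (Sum.inr (s₀ + d, true)) := by
        rcases eq_or_lt_of_le h2 with rfl | h2
        · exact hQ.mixed_last hn hn3 ht fun j hj => by have := hP j hj; omega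
        · exact hQ.mixed hn hn3 (fun j hj => by have := hP j hj; omega) d h1 h2
      refine ⟨s - s₀, ?_⟩
      have := (h0 (β (s - s₀))).shiftBy_inr (s - s₀)
      rwa [add_sub_cancel, add_right_comm, add_sub_cancel] at this
    have hpp : ∀ (b : Bool) (s s' : ZMod g), s ≠ s' →
        ∃ i, Joins (F i) (Sum.inr (s, b)) (Sum.inr (s', b)) := by
      intro b s s' hne
      obtain ⟨d, h1, h2, rfl | rfl⟩ := exists_natCast_add_of_ne (a := a) (by omega) hne
      · exact hp b s d h1 h2
      · exact (hp b s' d h1 h2).imp fun _ h => h.symm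
    have hmm := fun s s' : ZMod g => exists_natCast_or_intCast_add (t + 1) (2 * ((n - 1) / 2)) s s'
    have hmm' : ∀ s s' : ZMod g, (∃ i, Joins (F i) (Sum.inr (s, false)) (Sum.inr (s', true))) ∨
        ∃ i < 2 * ((n - 1) / 2),
          MixedPair (((t + 1 : ℕ) : ZMod g) + (i : ZMod g)) (s, false) (s', true) := by
      intro s s'
      rcases hmm s s' with ⟨i, hi, rfl⟩ | ⟨d, h1, h2, rfl⟩
      · exact Or.inr ⟨i, hi, rfl, rfl, rfl⟩
      · exact Or.inl (hm s d (by omega) (by omega))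
    rintro ⟨s, _ | _⟩ ⟨s', _ | _⟩ hne
    · exact Or.inl (hpp false s s' fun h => hne (by rw [h]))
    · exact (hmm' s s').imp_right Or.inl
    · exact (hmm' s' s).imp (fun ⟨i, h⟩ => ⟨i, h.symm⟩) Or.inr
    · exact Or.inl (hpp true s s' fun h => hne (by rw [h]))

/-- `LevelCover` on two disjoint copies. -/
theorem LevelCover.prod_bool {V : Type*} {N : ℕ} {R : V → V → Prop} (hR : LevelCover h N R) :
    LevelCover h N fun x y : V × Bool => x.2 = y.2 ∧ R x.1 y.1 := by
  obtain ⟨U, h1, h2⟩ := hR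
  refine ⟨fun j => Equiv.prodCongr (U j) (Equiv.refl _), fun j => ?_, ?_⟩
  · obtain ⟨p, hp⟩ := h1 j
    exact ⟨fun x => p x.1, fun x => hp x.1⟩
  · rintro ⟨x, b⟩ ⟨y, b'⟩ ⟨rfl : b = b', hxy⟩
    obtain ⟨j, hj | hj⟩ := h2 x y hxy
    · exact ⟨j, Or.inl (Prod.ext hj rfl)⟩
    · exact ⟨j, Or.inr (Prod.ext hj rfl)⟩

/-- For `n < g` the Hamilton cycles take all pure differences (`a` is half of `g`, rounded down) and
the 2-factors take `n - 1` mixed ones. For `n ≥ g` there are enough 2-factors to hold the complete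
graphs on both copies, so `a = 0` and the Hamilton cycles are purely mixed on the copies. In this
second case `n < 2 * g` is what gives `t ≥ 1`. -/
theorem hasBaseCover (hn : Odd n) (hn3 : 3 ≤ n) (hng : n < 2 * g) (hhn : h ∣ n) (hhg : h ∣ g) :
    HasBaseCover h n g := by
  obtain ⟨q, rfl⟩ := hn
  have hh : h ∣ 2 * g + (2 * q + 1) := (hhg.mul_left 2).add hhn
  rcases Nat.even_or_odd' g with ⟨r, hg | hg⟩
  · rcases lt_or_ge (2 * q + 1) g with h1 | h1
    · exact hasBaseCover_of_two_translates (a := r) (t := r - q) hg (by omega) hn3 (by omega)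
        hh hhg
    · subst hg
      -- The mixed differences left over number `2 * (q - r) + 1`, which is odd: the first, `t = 2 *
      -- r - q`, goes into the prism and the others are paired.
      have hR := (levelCover_prism (by omega) hhg ((2 * r - q : ℕ) : ZMod (2 * r))).add
        (levelCover_mixed hhg ((2 * r - q + 1 : ℕ) : ZMod (2 * r)) (q - r))
      rw [show r + (q - r) = (2 * q + 1 - 1) / 2 by omega] at hR
      refine hasBaseCover_of_translates (a := 0) (t := 2 * r - q) (by omega) hn3 (by omega) hh
        _ hR (fun b s s' hne => Or.inr (Or.inl (Or.inl ⟨rfl, fun h => hne (congrArg Prod.fst h)⟩)))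
        fun s s' => ?_
      rcases exists_natCast_or_intCast_add (2 * r - q) (2 * (q - r) + 1) s s' with
        ⟨i, hi, rfl⟩ | ⟨d, h2, h3, rfl⟩
      · right
        rcases i with _ | i
        · exact Or.inl (Or.inr ⟨rfl, rfl, by simp⟩)
        · exact Or.inr ⟨i, by omega, rfl, rfl, by push_cast; ring⟩
      · exact Or.inl ⟨d, by omega, by omega, rfl⟩
  · rcases lt_or_ge (2 * q + 1) g with h1 | h1
    · have hR := levelCover_mixed hhg ((r + 1 - q : ℕ) : ZMod g) ((2 * q + 1 - 1) / 2)
      refine hasBaseCover_of_translates (a := r) (t := r + 1 - q) (by omega) hn3 (by omega) hh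
        _ hR (fun b s s' hne => Or.inl (exists_natCast_add_of_ne (by omega) hne)) fun s s' => ?_
      rcases exists_natCast_or_intCast_add (r + 1 - q) (2 * ((2 * q + 1 - 1) / 2)) s s' with
        ⟨i, hi, rfl⟩ | ⟨d, h2, h3, rfl⟩
      · exact Or.inr ⟨i, hi, rfl, rfl, rfl⟩
      · exact Or.inl ⟨d, by omega, by omega, rfl⟩
    -- For odd `g` the complete graphs on the copies decompose by themselves, and the `2 * (q - r)`
    -- mixed differences from `t = g - q` on are paired.
    · have hR := (levelCover_complete (V := ZMod g) (h := h) (r := r) (by omega)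
        (by rw [ZMod.card, hg]) (hg ▸ hhg)).prod_bool.add
        (levelCover_mixed hhg ((g - q : ℕ) : ZMod g) (q - r))
      rw [show r + (q - r) = (2 * q + 1 - 1) / 2 by omega] at hR
      refine hasBaseCover_of_translates (a := 0) (t := g - q) (by omega) hn3 (by omega) hh
        _ hR (fun b s s' hne => Or.inr (Or.inl ⟨rfl, hne⟩)) fun s s' => ?_
      rcases exists_natCast_or_intCast_add (g - q) (2 * (q - r)) s s' with
        ⟨i, hi, rfl⟩ | ⟨d, h2, h3, rfl⟩
      · exact Or.inr (Or.inr ⟨i, hi, rfl, rfl, rfl⟩)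
      · exact Or.inl ⟨d, by omega, by omega, rfl⟩

end

/-! ### Sufficiency and the theorem -/

theorem nonempty_UMSF {h n g : ℕ} (hh3 : 3 ≤ h) (hn : Odd n) (hn0 : 0 < n) (hng : n < 2 * g)
    (hhn : h ∣ n) (hhg : h ∣ g) : Nonempty (UMSF (2 * n + 4 * g) (2 * n) (2 * h)) := by
  have hn3 : 3 ≤ n := hh3.trans (Nat.le_of_dvd hn0 hhn)
  have : NeZero n := ⟨by omega⟩
  have : NeZero g := ⟨by omega⟩
  obtain ⟨F, hF, hFc, R, ⟨U, hU, hUc⟩, hR⟩ := hasBaseCover hn hn3 hng hhn hhg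
  obtain ⟨q, rfl⟩ := hn
  obtain ⟨T, hT, hTc⟩ := levelCover_complete (V := Fin (2 * q + 1)) (r := q) (by omega)
    (Fintype.card_fin _) hhn
  choose F' hF' hF'c using fun i => (hF i).exists_double (by omega : 2 ≤ h)
  choose U' hU' hU'c using fun i => (hU i).exists_double (by omega : 2 ≤ h)
  choose T' hT' hT'c using fun i => (hT i).exists_double (by omega : 2 ≤ h)
  -- Each of the `g` Hamilton cycles of the base gives two of the `2 * g` factors `F i`.
  obtain ⟨eF⟩ : Nonempty (Fin ((2 * (2 * q + 1) + 4 * g - 1) / 2 - (2 * (2 * q + 1) - 1) / 2) ≃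
      ZMod g × Bool) := ⟨Fintype.equivOfCardEq (by
    rw [Fintype.card_fin, Fintype.card_prod, ZMod.card, Fintype.card_bool]; omega)⟩
  obtain ⟨eT⟩ : Nonempty (Fin ((2 * (2 * q + 1) - 1) / 2) ≃ Fin q × Bool) :=
    ⟨Fintype.equivOfCardEq (by
      rw [Fintype.card_fin, Fintype.card_prod, Fintype.card_fin, Fintype.card_bool]; omega)⟩
  have hq : q = (2 * q + 1 - 1) / 2 := by omega
  refine nonempty_UMSF_of_perms (A := Fin (2 * q + 1)) (B := ZMod g × Bool) (by omega)
    (by simp) (by simp; ring) (by simp)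
    (fun i => F' (eF i).1 (eF i).2) (fun i => T' (eT i).1 (eT i).2)
    (fun i => U' (Fin.cast hq (eT i).1) (eT i).2) (fun i => hF' _ _) (fun i => hT' _ _)
    (fun i => hU' _ _) ?_ ?_ ?_
  · intro a a' s t hne
    obtain ⟨j, hj⟩ := hTc a a' hne
    obtain ⟨c, hc⟩ := hT'c j a a' s t hj
    exact ⟨eT.symm (j, c), by simpa using hc⟩
  · intro a b s t
    obtain ⟨j, hj⟩ := hFc a b
    obtain ⟨c, hc⟩ := hF'c j _ _ s t hj
    exact ⟨eF.symm (j, c), by simpa using hc⟩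
  · have key : ∀ b b' s t, R b b' →
        ∃ j, Joins (U' (Fin.cast hq (eT j).1) (eT j).2) (b, s) (b', t) := by
      intro b b' s t h
      obtain ⟨j, hj⟩ := hUc b b' h
      obtain ⟨c, hc⟩ := hU'c j _ _ s t hj
      exact ⟨eT.symm (Fin.cast hq.symm j, c), by simpa using hc⟩
    intro b b' s t hne
    rcases hR b b' hne with ⟨j, hj⟩ | h | h
    · obtain ⟨c, hc⟩ := hF'c j _ _ s t hj
      exact Or.inl ⟨eF.symm (j, c), by simpa using hc⟩
    · exact Or.inr (key b b' s t h)
    · exact Or.inr ((key b' b t s h).imp fun _ h => h.symm)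

theorem mainTheorem9 (v m k : ℕ) (hk : 3 < k) (hk4 : k ≡ 2 [MOD 4])
    (hvm : v ≡ m [MOD 2 * k]) (hmk : m ≡ k [MOD 2 * k]) (hlt : m < v) :
    Nonempty (UMSF v m k) ↔ 2 * m ≤ v := by
  obtain ⟨u, rfl⟩ : ∃ u, k = 2 * (2 * u + 1) := ⟨k / 4, by unfold Nat.ModEq at hk4; omega⟩
  obtain ⟨c, hc⟩ := (Nat.modEq_iff_dvd' hlt.le).1 hvm.symm
  have hkm : 2 * (2 * u + 1) ≤ m := by
    by_contra hlt'
    have := Nat.ModEq.eq_of_lt_of_lt hmk (by omega) (by omega)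
    omega
  obtain ⟨d, hd⟩ := (Nat.modEq_iff_dvd' hkm).1 hmk.symm
  obtain ⟨n, hn⟩ : ∃ n, n = (2 * u + 1) * (2 * d + 1) := ⟨_, rfl⟩
  obtain ⟨g, hg⟩ : ∃ g, g = (2 * u + 1) * c := ⟨_, rfl⟩
  have hm : m = 2 * n := by
    rw [hn, (Nat.sub_eq_iff_eq_add hkm).1 hd]; ring
  have hv : v = 2 * n + 4 * g := by
    rw [← hm, hg, (Nat.sub_eq_iff_eq_add hlt.le).1 hc]; ring
  have hodd : Odd n := hn ▸ (odd_two_mul_add_one u).mul (odd_two_mul_add_one d)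
  clear hvm hmk hc hd hk4
  subst hv hm
  constructor
  · rintro ⟨S⟩
    exact two_mul_le_of_UMSF ⟨n + 2 * g, by ring⟩ ⟨n, by ring⟩ hlt S
  · intro h
    obtain ⟨q, hq⟩ := hodd
    -- The inequality gives `n ≤ 2 * g`, which is strict because `n` is odd; `3 < k` forces the odd
    -- number `2 * u + 1` to be at least `3`.
    exact nonempty_UMSF (by omega) ⟨q, hq⟩ (by omega) (by omega) (Dvd.intro _ hn.symm)
      (Dvd.intro _ hg.symm)
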